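/- **Setting.** For an operator $A$ on a real inner product space let $A^t$ be its transpose and $S(A)=\frac12(A+A^t)$. A *metric reductive decomposition* $(\mathfrak g=\mathfrak k\oplus\mathfrak p,\langle\cdot,\cdot\rangle)$ consists of a finite-dimensional real Lie algebra $\mathfrak g$, a subalgebra $\mathfrak k$, a complementary subspace $\mathfrak p$ with $[\mathfrak k,\mathfrak p]\subset\mathfrak p$, and an $\operatorname{ad}\mathfrak k$-invariant inner product on $\mathfrak g$ with $\langle\mathfrak k,\mathfrak p\rangle=0$. Its *Ricci operator* is $$\operatorname{Ric}=M-\tfrac12B_{\mathfrak p}-S(\operatorname{ad}_{\mathfrak p}H):\mathfrak p\to\mathfrak p,$$ where $\langle H,X\rangle=\operatorname{tr}\operatorname{ad}X$ for all $X\in\mathfrak g$, $\operatorname{ad}_{\mathfrak p}H=[H,\cdot]_{\mathfrak p}$, $\langle B_{\mathfrak p}X,Y\rangle$ is the Killing form of $\mathfrak g$ at $X,Y\in\mathfrak p$, and, for an orthonormal basis $\{X_i\}$ of $\mathfrak p$, $$\langle MX,Y\rangle=-\tfrac12\sum_{i,j}\langle[X,X_i]_{\mathfrak p},X_j\rangle\langle[Y,X_i]_{\mathfrak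 p},X_j\rangle+\tfrac14\sum_{i,j}\langle[X_i,X_j]_{\mathfrak p},X\rangle\langle[X_i,X_j]_{\mathfrak p},Y\rangle .$$ A Lie algebra with an inner product is regarded as the case $\mathfrak k=0$. **Construction.** Let the following data be given. * A nilpotent Lie algebra $\mathfrak n$ with an inner product whose Ricci operator is $\operatorname{Ric}_{\mathfrak n}=cI+D_1$ for some $c<0$ and some derivation $D_1$ of $\mathfrak n$. * A metric reductive decomposition $(\mathfrak u=\mathfrak k\oplus\mathfrak h,\langle\cdot,\cdot\rangle_{\mathfrak u})$ with $\mathfrak u$ a reductive Lie algebra. * A Lie algebra homomorphism $\theta:\mathfrak u\to\operatorname{Der}(\mathfrak n)$ such that $\theta(Z)^t=-\theta(Z)$ for all $Z\in\mathfrak k$; $\sum_i[\theta(Y_i),\theta(Y_i)^t]=0$ for any orthonormal basis $\{Y_i\}$ of $\mathfrak h$; and $\operatorname{Ric}_{\mathfrak u}=cI+C_\theta$, where $C_\theta$ is the symmetric operator of $\mathfrak h$ with $\langle C_\theta Y,Y\rangle=\operatorname{tr}S(\theta(Y))^2$ for all $Y\in\mathfrak h$. Let $\mathfrak g=\mathfrak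 u\ltimes_\theta\mathfrak n$, with the metric reductive decomposition $\mathfrak g=\mathfrak k\oplus\mathfrak p$, $\mathfrak p=\mathfrak h\oplus\mathfrak n$, whose inner product extends those of $\mathfrak u$ and $\mathfrak n$ and satisfies $\mathfrak u\perp\mathfrak n$. **Proposition.** Let $G$ be a simply connected Lie group with Lie algebra $\mathfrak g$ as above, let $K\subset G$ be a closed connected Lie subgroup with Lie algebra $\mathfrak k$, and let $U$ and $N$ be the connected Lie subgroups of $G$ with Lie algebras $\mathfrak u$ and $\mathfrak n$. Then: 1. $U$ acts smoothly on $N$ by conjugation, and $(n,u)\mapsto nu$ is an isomorphism of Lie groups from the corresponding semidirect product $U\ltimes N$ (with the product manifold structure) onto $G$; 2. $U$ and $N$ are simply connected; 3. $K\subset U$, the coset spaces $G/K$ and $U/K$ carry smooth structures, compatible with the quotient topologies, for which the projections $G\to G/K$ and $U\to U/K$ are smooth submersions, and with any such structures $G/K$ is diffeomorphic to $U/K\times N$. -/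

import Mathlib

open scoped Manifold ContDiff

/-! ### Metric reductive decompositions and their Ricci operators -/

/-- A positive definite symmetric bilinear form on a real vector space.  It is kept as a bilinear
form, and not as an `InnerProductSpace` instance, because the spaces that carry it are already Lie
rings. -/
structure InnerForm (V : Type*) [AddCommGroup V] [Module ℝ V] where
  form : LinearMap.BilinForm ℝ V
  symm : ∀ X Y, form X Y = form Y X
  pos : ∀ X, X ≠ 0 → 0 < form X X

namespace InnerForm

variable {V : Type*} [AddCommGroup V] [Module ℝ V] (ip : InnerForm V)

theorem nondegenerate : ip.form.Nondegenerate := by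
  refine ⟨fun x hx => ?_, fun x hx => ?_⟩ <;> by_contra h <;>
    exact (ip.pos x h).ne' (hx x)

/-- Orthonormality of a family. -/
def IsOrthonormal {ι : Type*} [DecidableEq ι] (b : ι → V) : Prop :=
  ∀ i j, ip.form (b i) (b j) = if i = j then 1 else 0

/-- The transpose `Aᵗ`, determined by `⟨Aᵗ X, Y⟩ = ⟨X, A Y⟩`. -/
noncomputable def transpose [FiniteDimensional ℝ V] (A : V →ₗ[ℝ] V) : V →ₗ[ℝ] V :=
  ip.form.leftAdjointOfNondegenerate ip.nondegenerate A

/-- The symmetric part `S(A) = (A + Aᵗ) / 2`. -/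
noncomputable def symPart [FiniteDimensional ℝ V] (A : V →ₗ[ℝ] V) : V →ₗ[ℝ] V :=
  (1 / 2 : ℝ) • (A + ip.transpose A)

end InnerForm

/-- A metric reductive decomposition `(𝔤 = 𝔨 ⊕ 𝔭, ⟨·,·⟩)`: a subalgebra `𝔨`, a complement `𝔭` with
`[𝔨, 𝔭] ⊆ 𝔭`, and an `ad 𝔨`-invariant inner product on `𝔤` with `𝔨 ⟂ 𝔭`. -/
structure MetricReductiveDecomposition (𝔤 : Type*) [LieRing 𝔤] [LieAlgebra ℝ 𝔤] where
  k : LieSubalgebra ℝ 𝔤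
  p : Submodule ℝ 𝔤
  isCompl : IsCompl k.toSubmodule p
  ip : InnerForm 𝔤
  orthogonal : ∀ Z ∈ k, ∀ X ∈ p, ip.form Z X = 0
  lie_mem : ∀ Z ∈ k, ∀ X ∈ p, ⁅Z, X⁆ ∈ p
  invariant : ∀ Z ∈ k, ∀ X Y, ip.form ⁅Z, X⁆ Y = -ip.form X ⁅Z, Y⁆

namespace MetricReductiveDecomposition

variable {𝔤 : Type*} [LieRing 𝔤] [LieAlgebra ℝ 𝔤]

/-- A metric Lie algebra, i.e. a Lie algebra with an inner product, is a metric reductive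
decomposition with `𝔨 = 0` and `𝔭 = 𝔤`. -/
def ofMetricLieAlgebra (ip : InnerForm 𝔤) : MetricReductiveDecomposition 𝔤 where
  k := ⊥
  p := ⊤
  isCompl := by simpa using isCompl_bot_top
  ip := ip
  orthogonal := by
    intro Z hZ X _
    rw [LieSubalgebra.mem_bot] at hZ
    simp [hZ]
  lie_mem := by intros; trivial
  invariant := by
    intro Z hZ X Y
    rw [LieSubalgebra.mem_bot] at hZ
    simp [hZ]

variable [FiniteDimensional ℝ 𝔤] (D : MetricReductiveDecomposition 𝔤)

/-- The vector `H` determined by `⟨H, X⟩ = tr (ad X)` for all `X ∈ 𝔤`. -/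
noncomputable def meanCurvature : 𝔤 :=
  (D.ip.form.toDual D.ip.nondegenerate).symm
    (LinearMap.trace ℝ 𝔤 ∘ₗ (LieAlgebra.ad ℝ 𝔤 : 𝔤 →ₗ[ℝ] Module.End ℝ 𝔤))

/-- The bilinear form `⟨M X, Y⟩` on `𝔭`, computed in a basis `b` of `𝔭` (to be taken orthonormal):
`-1/2 ∑ ⟨[X,Xᵢ]_𝔭, Xⱼ⟩⟨[Y,Xᵢ]_𝔭, Xⱼ⟩ + 1/4 ∑ ⟨[Xᵢ,Xⱼ]_𝔭, X⟩⟨[Xᵢ,Xⱼ]_𝔭, Y⟩`.  As `𝔨 ⟂ 𝔭` and the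
brackets are paired with vectors of `𝔭` only, projecting them to `𝔭` would change nothing. -/
noncomputable def momentForm {ι : Type*} [Fintype ι] (b : Module.Basis ι ℝ D.p) (X Y : D.p) : ℝ :=
  -(1 / 2) * ∑ i, ∑ j, D.ip.form ⁅(X : 𝔤), (b i : 𝔤)⁆ (b j) * D.ip.form ⁅(Y : 𝔤), (b i : 𝔤)⁆ (b j)
    + (1 / 4) * ∑ i, ∑ j, D.ip.form ⁅(b i : 𝔤), (b j : 𝔤)⁆ X * D.ip.form ⁅(b i : 𝔤), (b j : 𝔤)⁆ Y

/-- The Ricci form `⟨(M - 1/2 B_𝔭 - S(ad_𝔭 H)) X, Y⟩` on `𝔭`, where `B` is the Killing form of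
`𝔤` and `ad_𝔭 H = [H, ·]_𝔭`. -/
noncomputable def ricciForm {ι : Type*} [Fintype ι] (b : Module.Basis ι ℝ D.p) (X Y : D.p) : ℝ :=
  D.momentForm b X Y - (1 / 2) * killingForm ℝ 𝔤 X Y
    - (1 / 2) * (D.ip.form ⁅D.meanCurvature, (X : 𝔤)⁆ Y + D.ip.form X ⁅D.meanCurvature, (Y : 𝔤)⁆)

/-- `R` is the Ricci operator `Ric = M - 1/2 B_𝔭 - S(ad_𝔭 H) : 𝔭 → 𝔭` of the metric reductive
decomposition. -/
def IsRicciOperator (R : D.p →ₗ[ℝ] D.p) : Prop :=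
  ∀ b : Module.Basis (Fin (Module.finrank ℝ D.p)) ℝ D.p,
    D.ip.IsOrthonormal (fun i => (b i : 𝔤)) →
      ∀ X Y : D.p, D.ip.form (R X) Y = D.ricciForm b X Y

end MetricReductiveDecomposition

/-! ### The construction -/

/-- The data set of the construction.  The Lie algebra `𝔲` is reductive in the sense that its
radical is its center, i.e. it is the sum of a semisimple ideal and its center. -/
structure SolitonData (𝔲 𝔫 : Type*) [LieRing 𝔲] [LieAlgebra ℝ 𝔲] [FiniteDimensional ℝ 𝔲]
    [LieRing 𝔫] [LieAlgebra ℝ 𝔫] [FiniteDimensional ℝ 𝔫] where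
  /-- the cosmological constant -/
  c : ℝ
  c_neg : c < 0
  /-- `(𝔫, ⟨·,·⟩_𝔫)` is a nilsoliton: `𝔫` is nilpotent and `Ric_𝔫 = c I + D₁` with `D₁` a
  derivation. -/
  ipN : InnerForm 𝔫
  nilpotent : LieRing.IsNilpotent 𝔫
  D₁ : LieDerivation ℝ 𝔫 𝔫
  RicN : (MetricReductiveDecomposition.ofMetricLieAlgebra ipN).p →ₗ[ℝ]
    (MetricReductiveDecomposition.ofMetricLieAlgebra ipN).p
  isRicciN : (MetricReductiveDecomposition.ofMetricLieAlgebra ipN).IsRicciOperator RicN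
  ricN_eq : ∀ X, (RicN X : 𝔫) = c • (X : 𝔫) + D₁ (X : 𝔫)
  /-- the metric reductive decomposition `(𝔲 = 𝔨 ⊕ 𝔥, ⟨·,·⟩_𝔲)`; here `𝔥` is `decU.p` -/
  decU : MetricReductiveDecomposition 𝔲
  reductive : LieAlgebra.HasCentralRadical ℝ 𝔲
  /-- the action of `𝔲` on `𝔫` by derivations -/
  θ : 𝔲 →ₗ⁅ℝ⁆ LieDerivation ℝ 𝔫 𝔫
  /-- `θ(Z)ᵗ = -θ(Z)` for `Z ∈ 𝔨` -/
  skew : ∀ Z ∈ decU.k, ipN.transpose (θ Z : 𝔫 →ₗ[ℝ] 𝔫) = -(θ Z : 𝔫 →ₗ[ℝ] 𝔫)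
  /-- `∑ [θ(Yᵢ), θ(Yᵢ)ᵗ] = 0` for any orthonormal basis of `𝔥` -/
  sum_comm : ∀ b : Module.Basis (Fin (Module.finrank ℝ decU.p)) ℝ decU.p,
    decU.ip.IsOrthonormal (fun i => (b i : 𝔲)) →
      ∑ i, ((θ (b i) : 𝔫 →ₗ[ℝ] 𝔫) ∘ₗ ipN.transpose (θ (b i) : 𝔫 →ₗ[ℝ] 𝔫)
        - ipN.transpose (θ (b i) : 𝔫 →ₗ[ℝ] 𝔫) ∘ₗ (θ (b i) : 𝔫 →ₗ[ℝ] 𝔫)) = 0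
  /-- the symmetric operator of `𝔥` with `⟨C Y, Y⟩ = tr S(θ(Y))²` -/
  Cθ : decU.p →ₗ[ℝ] decU.p
  Cθ_symm : ∀ Y Y' : decU.p, decU.ip.form (Cθ Y) Y' = decU.ip.form Y (Cθ Y')
  Cθ_eq : ∀ Y : decU.p, decU.ip.form (Cθ Y) Y = LinearMap.trace ℝ 𝔫
    (ipN.symPart (θ Y : 𝔫 →ₗ[ℝ] 𝔫) ∘ₗ ipN.symPart (θ Y : 𝔫 →ₗ[ℝ] 𝔫))
  /-- `Ric_𝔲 = c I + C_θ` -/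
  isRicciU : decU.IsRicciOperator (c • LinearMap.id + Cθ)

namespace SolitonData

open LieAlgebra

variable {𝔲 𝔫 : Type*} [LieRing 𝔲] [LieAlgebra ℝ 𝔲] [FiniteDimensional ℝ 𝔲]
  [LieRing 𝔫] [LieAlgebra ℝ 𝔫] [FiniteDimensional ℝ 𝔫] (S : SolitonData 𝔲 𝔫)

theorem form_θ {Z : 𝔲} (hZ : Z ∈ S.decU.k) (X Y : 𝔫) :
    S.ipN.form (S.θ Z X) Y = -S.ipN.form X (S.θ Z Y) := by
  have h := S.ipN.form.isAdjointPairLeftAdjointOfNondegenerate S.ipN.nondegenerate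
    (S.θ Z : 𝔫 →ₗ[ℝ] 𝔫) X Y
  have h2 := S.skew Z hZ
  unfold InnerForm.transpose at h2
  rw [h2] at h
  simp only [LinearMap.neg_apply, map_neg] at h
  have h3 : -S.ipN.form (S.θ Z X) Y = S.ipN.form X (S.θ Z Y) := h
  linarith

/-- The Lie algebra `𝔤 = 𝔲 ⋉_θ 𝔫` of the construction. -/
abbrev total : Type _ := 𝔫 ⋊⁅S.θ⁆ 𝔲

/-- The inner product on `𝔤` that extends those of `𝔲` and `𝔫` and makes `𝔲 ⟂ 𝔫`. -/
def totalForm : InnerForm S.total where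
  form := LinearMap.mk₂ ℝ
    (fun x y => S.ipN.form x.left y.left + S.decU.ip.form x.right y.right)
    (by intro x y z; simp; ring) (by intro c x y; simp; ring)
    (by intro x y z; simp; ring) (by intro c x y; simp; ring)
  symm := by
    intro x y
    simp [S.ipN.symm x.left, S.decU.ip.symm x.right]
  pos := by
    intro x hx
    have hn : ∀ v, 0 ≤ S.ipN.form v v := fun v => by
      by_cases hv : v = 0
      · simp [hv]
      · exact (S.ipN.pos v hv).le
    have hu : ∀ v, 0 ≤ S.decU.ip.form v v := fun v => by
      by_cases hv : v = 0
      · simp [hv]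
      · exact (S.decU.ip.pos v hv).le
    simp only [LinearMap.mk₂_apply]
    by_cases h1 : x.left = 0
    · have h2 : x.right ≠ 0 := fun h2 => hx (SemiDirectSum.ext h1 h2)
      have := S.decU.ip.pos _ h2
      linarith [hn x.left]
    · have := S.ipN.pos _ h1
      linarith [hu x.right]

/-- The metric reductive decomposition `(𝔤 = 𝔨 ⊕ 𝔭, ⟨·,·⟩)` with `𝔭 = 𝔥 ⊕ 𝔫` that the construction
produces. -/
def totalDec : MetricReductiveDecomposition S.total where
  k := S.decU.k.map (SemiDirectSum.inr S.θ)
  p := S.decU.p.comap (SemiDirectSum.projr S.θ : S.total →ₗ[ℝ] 𝔲)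
  isCompl := by
    constructor
    · rw [Submodule.disjoint_def]
      rintro x ⟨z, hz, rfl⟩ hp
      have : z = 0 := Submodule.disjoint_def.1 S.decU.isCompl.disjoint z hz hp
      subst this
      exact map_zero _
    · rw [codisjoint_iff, eq_top_iff]
      rintro x -
      obtain ⟨z, hz, y, hy, h⟩ := Submodule.mem_sup.1
        (S.decU.isCompl.codisjoint.eq_top ▸ Submodule.mem_top : x.right ∈ _ ⊔ S.decU.p)
      refine Submodule.mem_sup.2 ⟨⟨0, z⟩, ⟨z, hz, rfl⟩, ⟨x.left, y⟩, hy, ?_⟩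
      ext <;> simp [h]
  ip := S.totalForm
  orthogonal := by
    rintro _ ⟨z, hz, rfl⟩ x hx
    have := S.decU.orthogonal z hz x.right hx
    simpa [totalForm] using this
  lie_mem := by
    rintro _ ⟨z, hz, rfl⟩ x hx
    exact S.decU.lie_mem z hz x.right hx
  invariant := by
    rintro _ ⟨z, hz, rfl⟩ x y
    have h1 := S.decU.invariant z hz x.right y.right
    have h2 := S.form_θ hz x.left y.left
    simp only [totalForm, LinearMap.mk₂_apply]
    simp [h1, h2]
    ring

/-- `𝔲` as a subspace of `𝔤`. -/
def uSub : Submodule ℝ S.total :=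
  LinearMap.range (SemiDirectSum.inr S.θ : 𝔲 →ₗ[ℝ] S.total)

/-- `𝔫` as a subspace of `𝔤`. -/
def nSub : Submodule ℝ S.total :=
  LinearMap.range (SemiDirectSum.inl S.θ : 𝔫 →ₗ[ℝ] S.total)

end SolitonData

/-! ### Lie subgroups and homogeneous spaces -/

section LieGroups

/-- Lie groups below are `C^∞`, while the bracket of `GroupLieAlgebra` asks for `C^3`. -/
instance lieGroup_minSmoothness_three {E : Type*} [NormedAddCommGroup E] [NormedSpace ℝ E]
    {G : Type*} [TopologicalSpace G] [ChartedSpace E G] [Group G] [LieGroup 𝓘(ℝ, E) ∞ G] :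
    LieGroup 𝓘(ℝ, E) (minSmoothness ℝ 3) G :=
  LieGroup.of_le (n := ∞) (by simp; exact ENat.LEInfty.out)

variable {E : Type*} [NormedAddCommGroup E] [NormedSpace ℝ E]
  {G : Type*} [TopologicalSpace G] [ChartedSpace E G] [Group G]

/-- The Lie group `L`, mapped to `G` by `ι`, is a Lie subgroup of `G` with Lie algebra `𝔰`: `ι` is a
smooth injective homomorphism and an immersion, and its derivative at `1` has image `𝔰`. -/
structure IsLieSubgroup {EL : Type*} [NormedAddCommGroup EL] [NormedSpace ℝ EL]
    {L : Type*} [TopologicalSpace L] [ChartedSpace EL L] [Group L]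
    (ι : L →* G) (𝔰 : Submodule ℝ (GroupLieAlgebra 𝓘(ℝ, E) G)) : Prop where
  injective : Function.Injective ι
  contMDiff : ContMDiff 𝓘(ℝ, EL) 𝓘(ℝ, E) ∞ ι
  immersion : ∀ x : L, Function.Injective (mfderiv 𝓘(ℝ, EL) 𝓘(ℝ, E) ι x)
  range_mfderiv : ∀ X : GroupLieAlgebra 𝓘(ℝ, E) G,
    X ∈ 𝔰 ↔ ∃ v : GroupLieAlgebra 𝓘(ℝ, EL) L, mfderiv 𝓘(ℝ, EL) 𝓘(ℝ, E) ι 1 v = X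

/-- The charted space structure `c` makes the coset space `G ⧸ K` (with the quotient topology) the
homogeneous manifold: it is a smooth manifold structure for which the projection `G → G ⧸ K` is a
smooth submersion.  There is at most one such smooth structure. -/
def IsHomogeneousManifold {F : Type*} [NormedAddCommGroup F] [NormedSpace ℝ F] (K : Subgroup G)
    (c : ChartedSpace F (G ⧸ K)) : Prop :=
  letI := c
  IsManifold 𝓘(ℝ, F) ∞ (G ⧸ K) ∧
    ContMDiff 𝓘(ℝ, E) 𝓘(ℝ, F) ∞ (fun g : G => (g : G ⧸ K)) ∧
    ∀ g : G, Function.Surjective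
      (mfderiv 𝓘(ℝ, E) 𝓘(ℝ, F) (fun g : G => (g : G ⧸ K)) g)

/-- `M` and `N₁ × N₂` are diffeomorphic, for the indicated charted space structures on `M` and
`N₁`. -/
def DiffeomorphicToProd {F₀ F₁ F₂ M N₁ N₂ : Type*}
    [NormedAddCommGroup F₀] [NormedSpace ℝ F₀] [NormedAddCommGroup F₁] [NormedSpace ℝ F₁]
    [NormedAddCommGroup F₂] [NormedSpace ℝ F₂]
    [TopologicalSpace M] [TopologicalSpace N₁] [TopologicalSpace N₂]
    (c₀ : ChartedSpace F₀ M) (c₁ : ChartedSpace F₁ N₁) [ChartedSpace F₂ N₂] : Prop :=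
  letI := c₀
  letI := c₁
  Nonempty (M ≃ₘ^∞⟮𝓘(ℝ, F₀), 𝓘(ℝ, F₁).prod 𝓘(ℝ, F₂)⟯ (N₁ × N₂))

/-- `G` is, as a Lie group, the semidirect product of its Lie subgroups `U` and `N`: `U` acts on `N`
smoothly by conjugation in `G`, and `(n, u) ↦ n u` is an isomorphism of groups `N ⋊ U → G` that is a
diffeomorphism from the product manifold. -/
def IsLieSemidirectProduct {EU EN U N : Type*}
    [NormedAddCommGroup EU] [NormedSpace ℝ EU] [NormedAddCommGroup EN] [NormedSpace ℝ EN]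
    [TopologicalSpace U] [ChartedSpace EU U] [Group U]
    [TopologicalSpace N] [ChartedSpace EN N] [Group N] (ιU : U →* G) (ιN : N →* G) : Prop :=
  ∃ φ : U →* MulAut N,
    ContMDiff (𝓘(ℝ, EU).prod 𝓘(ℝ, EN)) 𝓘(ℝ, EN) ∞ (fun x : U × N => φ x.1 x.2) ∧
    (∀ u n, ιN (φ u n) = ιU u * ιN n * (ιU u)⁻¹) ∧
    ∃ (Φ : N ⋊[φ] U ≃* G) (Ψ : (N × U) ≃ₘ^∞⟮𝓘(ℝ, EN).prod 𝓘(ℝ, EU), 𝓘(ℝ, E)⟯ G),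
      (∀ x, Φ x = ιN x.left * ιU x.right) ∧ ∀ x, Ψ (x.left, x.right) = Φ x

end LieGroups

/-!
# Semidirect product decomposition of a simply connected Lie group

Let `V` be the ideal `𝔫` of `𝔤`. Along a segment in the chart at `1`, the component of `Ad` that
maps `V` to a complement solves a homogeneous linear differential equation, because the derivative of
`Ad` at `1` is the bracket (`modelBracket_apply`, `HasLogDerivAt.adjointRep`). By Grönwall's
inequality it vanishes, so that `V` is `Ad(G)`-stable (`adjointRep_mem_of_ideal`). Differentiating
`Ad` along `N` then shows that `N` acts trivially on `𝔤 / 𝔫` (`adjointRep_sub_mem_of_ideal`).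

As `𝔤 = 𝔫 ⊕ 𝔲`, the map `(n, u) ↦ n u` is a local diffeomorphism `N × U → G`. A smooth map `f` into
`G` therefore factors locally as `f(x₀) n(x) u(x)`, and comparing logarithmic derivatives, with `𝔫`
stable under `Ad`, shows that `n` (or `u`) is locally constant if `f` is tangent to `U` (or to `N`).
Hence a map from a connected manifold that is tangent to `N` or `U` and meets it is a smooth map
into it (`exists_contMDiff_lift`); no Frobenius theorem is needed. This applies to `(u, n) ↦ u n u⁻¹`, so
that `U` acts smoothly on `N`, and to the inclusion of `K`, so that `K ⊆ U`.

The map `(n, u) ↦ n u` is now a homomorphism `N ⋊ U → G` from a connected group, and a local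
homeomorphism, hence a covering; since `G` is simply connected, it is bijective
(`MonoidHom.bijective_of_isLocalHomeomorph`), and so a diffeomorphism. The factors `U` and `N` are
retracts of `G`, hence simply connected.

The group `K` carries the subspace topology, so that its inclusions into `G` and `U` are embeddings.
The inverse function theorem gives slices for its right translations (`exists_cosetSlice`), whose
translates are charts of the coset spaces. Finally `n u K ↦ (u K, n)` is a bijection, and it is
smooth in both directions because maps out of the base of a surjective submersion are smooth as soon as
their compositions with the submersion are (`contMDiff_of_comp_submersion`).
-/

open Set Filter Topology

set_option linter.unusedSectionVars false

/-! ### Calculus on manifolds without boundary -/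

section ManifoldCalculus

variable {E : Type*} [NormedAddCommGroup E] [NormedSpace ℝ E]
  {H : Type*} [TopologicalSpace H] {I : ModelWithCorners ℝ E H}
  {M : Type*} [TopologicalSpace M] [ChartedSpace H M]
  {E' : Type*} [NormedAddCommGroup E'] [NormedSpace ℝ E']
  {H' : Type*} [TopologicalSpace H'] {I' : ModelWithCorners ℝ E' H'}
  {M' : Type*} [TopologicalSpace M'] [ChartedSpace H' M']
  {E'' : Type*} [NormedAddCommGroup E''] [NormedSpace ℝ E'']
  {H'' : Type*} [TopologicalSpace H''] {I'' : ModelWithCorners ℝ E'' H''}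
  {M'' : Type*} [TopologicalSpace M''] [ChartedSpace H'' M'']

variable (I) in
/-- The preferred extended chart at `x` as a smooth partial diffeomorphism onto an open subset of
the model vector space; this needs the manifold to have no boundary. -/
noncomputable def extChartDiffeo [I.Boundaryless] [IsManifold I ∞ M] (x : M) :
    PartialDiffeomorph I 𝓘(ℝ, E) M E ∞ where
  toPartialEquiv := extChartAt I x
  open_source := isOpen_extChartAt_source x
  open_target := isOpen_extChartAt_target x
  contMDiffOn_toFun := by
    rw [extChartAt_source]; exact contMDiffOn_extChartAt
  contMDiffOn_invFun := contMDiffOn_extChartAt_symm x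

/-- A partial diffeomorphism may be replaced by its restriction to an open subset of its source. -/
noncomputable def PartialDiffeomorph.restrOpen (Φ : PartialDiffeomorph I I' M M' ∞) (s : Set M)
    (hs : IsOpen s) : PartialDiffeomorph I I' M M' ∞ where
  __ := Φ.toOpenPartialHomeomorph.restrOpen s hs
  contMDiffOn_toFun := Φ.contMDiffOn_toFun.mono inter_subset_left
  contMDiffOn_invFun := Φ.contMDiffOn_invFun.mono inter_subset_left

section CoordDeriv

variable (I I') in
/-- `HasMFDerivAt`, with the derivative regarded as a map between the model vector spaces rather
than between tangent spaces. The type of the derivative then does not depend on the base point, so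
that equalities between base points can be rewritten freely. -/
def HasCoordDerivAt (f : M → M') (x : M) (f' : E →L[ℝ] E') : Prop :=
  HasMFDerivAt I I' f x f'

variable (I I') in
/-- `mfderiv`, regarded as a map between the model vector spaces. -/
noncomputable def coordDeriv (f : M → M') (x : M) : E →L[ℝ] E' := mfderiv I I' f x

variable {f g : M → M'} {x : M} {f' g' : E →L[ℝ] E'}

theorem MDifferentiableAt.hasCoordDerivAt (h : MDifferentiableAt I I' f x) :
    HasCoordDerivAt I I' f x (coordDeriv I I' f x) :=
  h.hasMFDerivAt

theorem HasCoordDerivAt.mdifferentiableAt (h : HasCoordDerivAt I I' f x f') :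
    MDifferentiableAt I I' f x :=
  HasMFDerivAt.mdifferentiableAt h

theorem HasCoordDerivAt.coordDeriv_eq (h : HasCoordDerivAt I I' f x f') :
    coordDeriv I I' f x = f' :=
  HasMFDerivAt.mfderiv h

theorem HasCoordDerivAt.unique (h : HasCoordDerivAt I I' f x f')
    (h' : HasCoordDerivAt I I' f x g') : f' = g' :=
  h.coordDeriv_eq.symm.trans h'.coordDeriv_eq

theorem HasCoordDerivAt.comp {k : M' → M''} {k' : E' →L[ℝ] E''} {y : M'} (x : M)
    (hk : HasCoordDerivAt I' I'' k y k') (h : HasCoordDerivAt I I' f x f') (hy : f x = y) :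
    HasCoordDerivAt I I'' (fun z => k (f z)) x (k' ∘L f') := by
  subst hy
  exact HasMFDerivAt.comp x hk h

theorem HasCoordDerivAt.congr (h : HasCoordDerivAt I I' f x f') (hg : g =ᶠ[𝓝 x] f) :
    HasCoordDerivAt I I' g x f' :=
  HasMFDerivAt.congr_of_eventuallyEq h hg

theorem HasCoordDerivAt.congr_deriv (h : HasCoordDerivAt I I' f x f') (hg : f' = g') :
    HasCoordDerivAt I I' f x g' := hg ▸ h

theorem HasCoordDerivAt.prodMk {k : M → M''} {k' : E →L[ℝ] E''}
    (h : HasCoordDerivAt I I' f x f') (hk : HasCoordDerivAt I I'' k x k') :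
    HasCoordDerivAt I (I'.prod I'') (fun z => (f z, k z)) x (f'.prod k') :=
  HasMFDerivAt.prodMk h hk

theorem hasCoordDerivAt_const (c : M') : HasCoordDerivAt I I' (fun _ => c) x 0 :=
  hasMFDerivAt_const c x

theorem hasCoordDerivAt_id : HasCoordDerivAt I I (fun z => z) x (ContinuousLinearMap.id ℝ E) :=
  hasMFDerivAt_id x

theorem hasCoordDerivAt_fst (p : M × M') :
    HasCoordDerivAt (I.prod I') I Prod.fst p (ContinuousLinearMap.fst ℝ E E') :=
  hasMFDerivAt_fst p

theorem hasCoordDerivAt_snd (p : M × M') :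
    HasCoordDerivAt (I.prod I') I' Prod.snd p (ContinuousLinearMap.snd ℝ E E') :=
  hasMFDerivAt_snd p

theorem hasCoordDerivAt_iff_hasFDerivAt {f : E → E'} {x : E} :
    HasCoordDerivAt 𝓘(ℝ, E) 𝓘(ℝ, E') f x f' ↔ HasFDerivAt f f' x :=
  hasMFDerivAt_iff_hasFDerivAt

/-- In the preferred chart at a point, the derivative of the chart at that point is the identity. -/
theorem hasCoordDerivAt_extChartAt [IsManifold I ∞ M] (x : M) :
    HasCoordDerivAt I 𝓘(ℝ, E) (extChartAt I x) x (ContinuousLinearMap.id ℝ E) := by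
  have h1 : IsManifold I 1 M := IsManifold.of_le (n := ∞) (by simp)
  have h := (mdifferentiableAt_extChartAt (I := I) (mem_chart_source H x)).hasCoordDerivAt
  exact h.congr_deriv mfderiv_extChartAt_self

theorem hasCoordDerivAt_extChartAt_symm [IsManifold I ∞ M] [I.Boundaryless] (x : M) :
    HasCoordDerivAt 𝓘(ℝ, E) I (extChartAt I x).symm (extChartAt I x x)
      (ContinuousLinearMap.id ℝ E) := by
  have h1 : IsManifold I 1 M := IsManifold.of_le (n := ∞) (by simp)
  have hmd : MDifferentiableAt 𝓘(ℝ, E) I (extChartAt I x).symm (extChartAt I x x) :=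
    (extChartDiffeo I x).symm.mdifferentiableAt (by simp) (mem_extChartAt_target x)
  have := mfderivWithin_range_extChartAt_symm (I := I) (x := x)
  rw [ModelWithCorners.Boundaryless.range_eq_univ, mfderivWithin_univ] at this
  exact hmd.hasCoordDerivAt.congr_deriv this

theorem coordDeriv_eq_fderiv_extChartAt [I.Boundaryless] (h : MDifferentiableAt I I' f x) :
    coordDeriv I I' f x = fderiv ℝ (extChartAt I' (f x) ∘ f ∘ (extChartAt I x).symm)
      (extChartAt I x x) := by
  have h1 : mfderiv I I' f x = fderivWithin ℝ (writtenInExtChartAt I I' x f) (range I)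
    (extChartAt I x x) := if_pos h
  rw [ModelWithCorners.Boundaryless.range_eq_univ, fderivWithin_univ] at h1
  exact h1

end CoordDeriv

/-- The inverse function theorem in a vector space, with smoothness of the inverse on a whole
neighborhood. -/
theorem isLocalDiffeomorphAt_of_fderiv [FiniteDimensional ℝ E] {g : E → E'} {a : E}
    (hg : ∀ᶠ y in 𝓝 a, ContDiffAt ℝ ∞ g y) (hb : Function.Bijective (fderiv ℝ g a)) :
    IsLocalDiffeomorphAt 𝓘(ℝ, E) 𝓘(ℝ, E') ∞ g a := by
  let L : E ≃L[ℝ] E' :=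
    (LinearEquiv.ofBijective (fderiv ℝ g a : E →ₗ[ℝ] E') hb).toContinuousLinearEquiv
  have hL : (L : E →L[ℝ] E') = fderiv ℝ g a := by ext; rfl
  have ha := hg.self_of_nhds
  have hd : HasFDerivAt g (L : E →L[ℝ] E') a := by
    rw [hL]; exact (ha.differentiableAt (by simp)).hasFDerivAt
  let Θ := ha.toOpenPartialHomeomorph g hd (by simp)
  have hinv : ∀ᶠ y in 𝓝 a, fderiv ℝ g y ∈ range ((↑) : (E ≃L[ℝ] E') → E →L[ℝ] E') := by
    have hc : ContinuousAt (fderiv ℝ g) a :=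
      (ha.fderiv_right (m := 0) (by simp)).continuousAt
    apply hc
    rw [← hL]
    have := FiniteDimensional.complete ℝ E
    exact L.nhds
  obtain ⟨s, hs, hso, has⟩ := eventually_nhds_iff.1 (hg.and hinv)
  let Θ' := Θ.restrOpen s hso
  have := FiniteDimensional.complete ℝ E
  refine ⟨⟨Θ'.toPartialEquiv, Θ'.open_source, Θ'.open_target, ?_, ?_⟩, ?_, ?_⟩
  · intro y hy
    exact (hs y hy.2).1.contMDiffAt.contMDiffWithinAt
  · intro z hz
    have hy : Θ'.symm z ∈ Θ'.source := Θ'.map_target hz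
    obtain ⟨L', hL'⟩ := (hs _ hy.2).2
    have h1 := (hs _ hy.2).1
    refine ContMDiffAt.contMDiffWithinAt (ContDiffAt.contMDiffAt ?_)
    refine Θ'.contDiffAt_symm (f₀' := L') hz ?_ h1
    rw [hL']
    exact (h1.differentiableAt (by simp)).hasFDerivAt
  · exact ⟨ha.mem_toOpenPartialHomeomorph_source hd (by simp), has⟩
  · intro y _
    rfl

theorem IsLocalDiffeomorphAt.congr_of_eventuallyEq {f g : M → M'} {x : M}
    (h : IsLocalDiffeomorphAt I I' ∞ g x) (hfg : f =ᶠ[𝓝 x] g) :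
    IsLocalDiffeomorphAt I I' ∞ f x := by
  obtain ⟨Φ, hx, hΦ⟩ := h
  obtain ⟨s, hs, hso, hxs⟩ := eventually_nhds_iff.1 hfg
  exact ⟨Φ.restrOpen s hso, ⟨hx, hxs⟩, fun y hy => (hs y hy.2).trans (hΦ hy.1)⟩

/-- The inverse function theorem for manifolds without boundary. -/
theorem isLocalDiffeomorphAt_of_mfderiv [FiniteDimensional ℝ E] [I.Boundaryless]
    [I'.Boundaryless] [IsManifold I ∞ M] [IsManifold I' ∞ M'] {f : M → M'} {x : M}
    (hf : ∀ᶠ y in 𝓝 x, ContMDiffAt I I' ∞ f y)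
    (hb : Function.Bijective (mfderiv I I' f x)) : IsLocalDiffeomorphAt I I' ∞ f x := by
  set φ := extChartDiffeo I x
  set ψ := extChartDiffeo I' (f x)
  let g : E → E' := fun v => ψ (f (φ.symm v))
  have hx0 : x ∈ φ.source := mem_extChartAt_source x
  have hfx0 : f x ∈ ψ.source := mem_extChartAt_source (f x)
  have hφx : φ.symm (φ x) = x := φ.left_inv hx0
  have hφc : ContinuousAt φ.symm (φ x) :=
    φ.symm.contMDiffOn.continuousOn.continuousAt (φ.open_target.mem_nhds (φ.map_source hx0))
  have hfev : ∀ᶠ y in 𝓝 x, y ∈ φ.source ∧ f y ∈ ψ.source ∧ ContMDiffAt I I' ∞ f y := by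
    filter_upwards [φ.open_source.mem_nhds hx0,
      hf.self_of_nhds.continuousAt.preimage_mem_nhds (ψ.open_source.mem_nhds hfx0), hf]
      with y h1 h2 h3 using ⟨h1, h2, h3⟩
  have hg : ∀ᶠ v in 𝓝 (φ x), ContDiffAt ℝ ∞ g v := by
    have h1 : ∀ᶠ v in 𝓝 (φ x), v ∈ φ.target := φ.open_target.mem_nhds (φ.map_source hx0)
    have h2 := hφc.eventually (p := fun y => y ∈ φ.source ∧ f y ∈ ψ.source ∧ ContMDiffAt I I' ∞ f y)
      (by rw [hφx]; exact hfev)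
    filter_upwards [h1, h2] with v hv ⟨h3, h4, h5⟩
    rw [← contMDiffAt_iff_contDiffAt]
    have a1 : ContMDiffAt 𝓘(ℝ, E) I ∞ φ.symm v :=
      φ.symm.contMDiffOn.contMDiffAt (φ.open_target.mem_nhds hv)
    have a2 : ContMDiffAt I' 𝓘(ℝ, E') ∞ ψ (f (φ.symm v)) :=
      ψ.contMDiffOn.contMDiffAt (ψ.open_source.mem_nhds h4)
    exact a2.comp v (h5.comp v a1)
  have hgd : fderiv ℝ g (φ x) = coordDeriv I I' f x :=
    (coordDeriv_eq_fderiv_extChartAt (hf.self_of_nhds.mdifferentiableAt (by simp))).symm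
  have hgl : IsLocalDiffeomorphAt 𝓘(ℝ, E) 𝓘(ℝ, E') ∞ g (φ x) :=
    isLocalDiffeomorphAt_of_fderiv hg (by rw [hgd]; exact hb)
  obtain ⟨Θ, hΘ, hΘe⟩ := hgl
  have hgx : g (φ x) = ψ (f x) := by simp only [g, hφx]
  refine IsLocalDiffeomorphAt.congr_of_eventuallyEq (g := (φ.trans Θ).trans ψ.symm)
    ⟨(φ.trans Θ).trans ψ.symm, ⟨⟨hx0, hΘ⟩, ?_⟩, fun _ _ => rfl⟩ ?_
  · change Θ (φ x) ∈ ψ.target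
    rw [← hΘe hΘ, hgx]
    exact ψ.map_source hfx0
  · have hφcont : ContinuousAt φ x := φ.contMDiffOn.continuousOn.continuousAt
      (φ.open_source.mem_nhds hx0)
    filter_upwards [hfev, hφcont.preimage_mem_nhds (Θ.open_source.mem_nhds hΘ)]
      with y ⟨h1, h2, _⟩ h4
    change f y = ψ.symm (Θ (φ y))
    rw [← hΘe h4]
    change f y = ψ.symm (ψ (f (φ.symm (φ y))))
    have : φ.symm (φ y) = y := φ.left_inv h1
    rw [this]
    exact (ψ.left_inv h2).symm

/-- A smooth map with surjective derivative at `x` has a smooth local section through `x`. -/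
theorem exists_local_section [FiniteDimensional ℝ E] [FiniteDimensional ℝ E'] [I.Boundaryless]
    [I'.Boundaryless] [IsManifold I ∞ M] [IsManifold I' ∞ M'] {f : M → M'} {x : M}
    (hf : ∀ᶠ y in 𝓝 x, ContMDiffAt I I' ∞ f y)
    (hs : Function.Surjective (mfderiv I I' f x)) :
    ∃ s : M' → M, s (f x) = x ∧ ContMDiffAt I' I ∞ s (f x) ∧ ∀ᶠ y in 𝓝 (f x), f (s y) = y := by
  set φ := extChartDiffeo I x
  have hx0 : x ∈ φ.source := mem_extChartAt_source x
  have hφx : φ.symm (φ x) = x := φ.left_inv hx0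
  let A : E →L[ℝ] E' := mfderiv I I' f x
  obtain ⟨R, hR⟩ := (A : E →ₗ[ℝ] E').exists_rightInverse_of_surjective
    (LinearMap.range_eq_top.2 hs)
  let R' : E' →L[ℝ] E := R.toContinuousLinearMap
  let l : E' → E := fun v => φ x + R' v
  have hl0 : l 0 = φ x := by simp [l]
  have hlc : ContDiff ℝ ∞ l := contDiff_const.add R'.contDiff
  let h : E' → M := fun v => φ.symm (l v)
  have hh0 : h 0 = x := by simp only [h, hl0, hφx]
  have hsm : ∀ᶠ v in 𝓝 (0 : E'), ContMDiffAt 𝓘(ℝ, E') I ∞ h v := by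
    have : ∀ᶠ v in 𝓝 (0 : E'), l v ∈ φ.target :=
      hlc.continuous.continuousAt.preimage_mem_nhds
        (φ.open_target.mem_nhds (by rw [hl0]; exact φ.map_source hx0))
    filter_upwards [this] with v hv
    exact (φ.symm.contMDiffOn.contMDiffAt (φ.open_target.mem_nhds hv)).comp v
      hlc.contDiffAt.contMDiffAt
  have hfh : ∀ᶠ v in 𝓝 (0 : E'), ContMDiffAt 𝓘(ℝ, E') I' ∞ (fun v => f (h v)) v := by
    have h2 := hsm.self_of_nhds.continuousAt.eventually (p := fun y => ContMDiffAt I I' ∞ f y)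
      (by rw [hh0]; exact hf)
    filter_upwards [hsm, h2] with v h3 h4 using h4.comp v h3
  have hder : HasCoordDerivAt 𝓘(ℝ, E') 𝓘(ℝ, E) l 0 R' :=
    hasCoordDerivAt_iff_hasFDerivAt.2 (R'.hasFDerivAt.const_add _)
  have hderh : HasCoordDerivAt 𝓘(ℝ, E') I h 0 R' :=
    HasCoordDerivAt.comp 0 (hasCoordDerivAt_extChartAt_symm (I := I) x) hder hl0
  have hderf : HasCoordDerivAt I I' f x A :=
    (hf.self_of_nhds.mdifferentiableAt (by simp)).hasCoordDerivAt
  have hderfh : HasCoordDerivAt 𝓘(ℝ, E') I' (fun v => f (h v)) 0 (A ∘L R') :=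
    hderf.comp 0 hderh hh0
  have hid : ∀ v, (A ∘L R') v = v := fun v => LinearMap.congr_fun hR v
  have hloc : IsLocalDiffeomorphAt 𝓘(ℝ, E') I' ∞ (fun v => f (h v)) 0 := by
    refine isLocalDiffeomorphAt_of_mfderiv hfh ?_
    change Function.Bijective (coordDeriv 𝓘(ℝ, E') I' (fun v => f (h v)) 0)
    rw [hderfh.coordDeriv_eq]
    exact ⟨fun a b hab => by rwa [hid, hid] at hab, fun b => ⟨b, hid b⟩⟩
  obtain ⟨Θ, hΘ, hΘe⟩ := hloc
  have hΘ0 : Θ 0 = f x := by rw [← hΘe hΘ]; simp [hh0]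
  have hfxt : f x ∈ Θ.target := hΘ0 ▸ Θ.map_source hΘ
  have hsym : Θ.symm (f x) = 0 := by rw [← hΘ0]; exact Θ.left_inv hΘ
  refine ⟨fun y => h (Θ.symm y), by simp only [hsym, hh0], ?_, ?_⟩
  · have h1 := Θ.symm.contMDiffOn.contMDiffAt (Θ.open_target.mem_nhds hfxt)
    have h2 : ContMDiffAt 𝓘(ℝ, E') I ∞ h (Θ.symm (f x)) := by rw [hsym]; exact hsm.self_of_nhds
    exact h2.comp (f x) h1
  · filter_upwards [Θ.open_target.mem_nhds hfxt] with y hy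
    have := hΘe (Θ.map_target hy)
    exact this.trans (Θ.right_inv hy)

/-- A map out of the base of a surjective submersion is smooth as soon as its composition with the
submersion is. -/
theorem contMDiff_of_comp_submersion [FiniteDimensional ℝ E] [FiniteDimensional ℝ E']
    [I.Boundaryless] [I'.Boundaryless] [IsManifold I ∞ M] [IsManifold I' ∞ M'] {π : M → M'}
    (hπ : ContMDiff I I' ∞ π) (hsub : ∀ x, Function.Surjective (mfderiv I I' π x))
    (hsurj : Function.Surjective π) {f : M' → M''} (hf : ContMDiff I I'' ∞ (fun x => f (π x))) :
    ContMDiff I' I'' ∞ f := by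
  intro y
  obtain ⟨x, rfl⟩ := hsurj y
  obtain ⟨s, -, hsm, hs⟩ := exists_local_section (Eventually.of_forall fun y => hπ y) (hsub x)
  refine ((hf _).comp (π x) hsm).congr_of_eventuallyEq ?_
  filter_upwards [hs] with y hy
  simp [hy]

/-- A map whose derivative vanishes near `x` is constant near `x`. -/
theorem eventually_eq_of_mfderiv_eq_zero [I.Boundaryless] [I'.Boundaryless]
    [IsManifold I ∞ M] [IsManifold I' ∞ M'] {f : M → M'} {x : M}
    (hf : ∀ᶠ y in 𝓝 x, HasCoordDerivAt I I' f y 0) : ∀ᶠ y in 𝓝 x, f y = f x := by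
  set φ := extChartDiffeo I x
  set ψ := extChartDiffeo I' (f x)
  let g : E → E' := fun v => ψ (f (φ.symm v))
  have hx0 : x ∈ φ.source := mem_extChartAt_source x
  have hfx0 : f x ∈ ψ.source := mem_extChartAt_source (f x)
  have hφx : φ.symm (φ x) = x := φ.left_inv hx0
  have hφc : ContinuousAt φ.symm (φ x) :=
    φ.symm.contMDiffOn.continuousOn.continuousAt (φ.open_target.mem_nhds (φ.map_source hx0))
  have hfev : ∀ᶠ y in 𝓝 x, y ∈ φ.source ∧ f y ∈ ψ.source ∧
      HasCoordDerivAt I I' f y 0 := by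
    filter_upwards [φ.open_source.mem_nhds hx0,
      hf.self_of_nhds.mdifferentiableAt.continuousAt.preimage_mem_nhds
        (ψ.open_source.mem_nhds hfx0), hf]
      with y h1 h2 h3 using ⟨h1, h2, h3⟩
  have hg : ∀ᶠ v in 𝓝 (φ x), HasFDerivAt g (0 : E →L[ℝ] E') v := by
    have h1 : ∀ᶠ v in 𝓝 (φ x), v ∈ φ.target := φ.open_target.mem_nhds (φ.map_source hx0)
    have h2 := hφc.eventually (p := fun y => y ∈ φ.source ∧ f y ∈ ψ.source ∧
      HasCoordDerivAt I I' f y 0) (by rw [hφx]; exact hfev)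
    filter_upwards [h1, h2] with v hv ⟨h3, h4, h5⟩
    have a1 := (φ.symm.mdifferentiableAt (by simp) hv : MDifferentiableAt 𝓘(ℝ, E) I φ.symm v)
    have a2 := ψ.mdifferentiableAt (by simp) h4
    have h6 := a2.hasCoordDerivAt.comp v (h5.comp v a1.hasCoordDerivAt rfl) rfl
    exact hasCoordDerivAt_iff_hasFDerivAt.1 (h6.congr_deriv (by ext; simp))
  obtain ⟨ε, hε, hball⟩ := Metric.eventually_nhds_iff_ball.1 hg
  have hconst : ∀ v ∈ Metric.ball (φ x) ε, g v = g (φ x) := by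
    intro v hv
    exact (convex_ball (φ x) ε).is_const_of_fderivWithin_eq_zero (𝕜 := ℝ) (f := g)
      (fun w hw => (hball w hw).differentiableAt.differentiableWithinAt)
      (fun w hw => by
        rw [fderivWithin_of_isOpen Metric.isOpen_ball hw, (hball w hw).fderiv])
      hv (Metric.mem_ball_self hε)
  have hφcont : ContinuousAt φ x := φ.contMDiffOn.continuousOn.continuousAt
    (φ.open_source.mem_nhds hx0)
  filter_upwards [hfev, hφcont.preimage_mem_nhds (Metric.ball_mem_nhds _ hε)] with y ⟨h1, h2, _⟩ h4
  have h5 := hconst _ h4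
  simp only [g, hφx, show φ.symm (φ y) = y from φ.left_inv h1] at h5
  exact ψ.injOn h2 hfx0 h5

end ManifoldCalculus

/-! ### Logarithmic derivatives and the adjoint representation -/

section LieGroupCalculus

variable {E : Type*} [NormedAddCommGroup E] [NormedSpace ℝ E]
  {G : Type*} [TopologicalSpace G] [ChartedSpace E G] [Group G]
  {EM : Type*} [NormedAddCommGroup EM] [NormedSpace ℝ EM]
  {HM : Type*} [TopologicalSpace HM] {IM : ModelWithCorners ℝ EM HM}
  {M : Type*} [TopologicalSpace M] [ChartedSpace HM M]

/-- The adjoint representation `Ad g`, the derivative at `1` of the conjugation by `g`. -/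
noncomputable def adjointRep (g : G) : E →L[ℝ] E :=
  coordDeriv 𝓘(ℝ, E) 𝓘(ℝ, E) (fun x : G => g * x * g⁻¹) 1

variable (IM) in
/-- `A` is the logarithmic derivative at `x` of the map `f` into a Lie group, i.e. the derivative at
`x` of `y ↦ f(x)⁻¹ f(y)`. -/
def HasLogDerivAt (f : M → G) (x : M) (A : EM →L[ℝ] E) : Prop :=
  HasCoordDerivAt IM 𝓘(ℝ, E) (fun y => (f x)⁻¹ * f y) x A

variable [LieGroup 𝓘(ℝ, E) ∞ G]

theorem hasCoordDerivAt_mul_one_one :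
    HasCoordDerivAt (𝓘(ℝ, E).prod 𝓘(ℝ, E)) 𝓘(ℝ, E) (fun p : G × G => p.1 * p.2) (1, 1)
      (ContinuousLinearMap.fst ℝ E E + ContinuousLinearMap.snd ℝ E E) := by
  have h : HasCoordDerivAt (𝓘(ℝ, E).prod 𝓘(ℝ, E)) 𝓘(ℝ, E) (fun p : G × G => p.1 * p.2) (1, 1) _ :=
    ((contMDiff_mul 𝓘(ℝ, E) ∞ (G := G)).mdifferentiable (by simp) (1, 1)).hasCoordDerivAt
  refine h.congr_deriv ?_
  have h1 := h.comp (1 : G) (hasCoordDerivAt_id.prodMk (hasCoordDerivAt_const (1 : G))) rfl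
  have h2 := h.comp (1 : G) ((hasCoordDerivAt_const (1 : G)).prodMk hasCoordDerivAt_id) rfl
  simp only [mul_one, one_mul] at h1 h2
  have h3 := h1.unique hasCoordDerivAt_id
  have h4 := h2.unique hasCoordDerivAt_id
  refine ContinuousLinearMap.ext fun ⟨v, w⟩ => ?_
  have e3 := DFunLike.congr_fun h3 v
  have e4 := DFunLike.congr_fun h4 w
  simp only [ContinuousLinearMap.comp_apply, ContinuousLinearMap.prod_apply,
    ContinuousLinearMap.id_apply, zero_apply] at e3 e4
  have : ((v, w) : E × E) = (v, 0) + (0, w) := by simp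
  rw [this, map_add, e3, e4]
  simp

theorem hasCoordDerivAt_conj (g : G) :
    HasCoordDerivAt 𝓘(ℝ, E) 𝓘(ℝ, E) (fun x : G => g * x * g⁻¹) 1 (adjointRep g) := by
  have h : ContMDiff 𝓘(ℝ, E) 𝓘(ℝ, E) ∞ (fun x : G => g * x * g⁻¹) :=
    (contMDiff_const.mul contMDiff_id).mul contMDiff_const
  exact (h.mdifferentiable (by simp) 1).hasCoordDerivAt

@[simp] theorem adjointRep_one :
    adjointRep (1 : G) = ContinuousLinearMap.id ℝ E := by
  refine (hasCoordDerivAt_conj (1 : G)).unique ?_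
  simpa using hasCoordDerivAt_id

theorem adjointRep_mul (g h : G) :
    adjointRep (g * h) = adjointRep g ∘L adjointRep (E := E) h := by
  refine (hasCoordDerivAt_conj (g * h)).unique ?_
  have := (hasCoordDerivAt_conj (E := E) g).comp 1 (hasCoordDerivAt_conj h) (by simp)
  convert this using 2
  group

@[simp] theorem adjointRep_inv_apply (g : G) (v : E) :
    adjointRep g⁻¹ (adjointRep g v) = v := by
  have := adjointRep_mul (E := E) g⁻¹ g
  rw [inv_mul_cancel, adjointRep_one] at this
  exact (DFunLike.congr_fun this v).symm

@[simp] theorem adjointRep_apply_inv (g : G) (v : E) :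
    adjointRep g (adjointRep g⁻¹ v) = v := by
  simpa using adjointRep_inv_apply g⁻¹ v

section LogDeriv

variable {f g : M → G} {x : M} {A B : EM →L[ℝ] E}

theorem HasCoordDerivAt.mul_of_eq_one (hf : HasCoordDerivAt IM 𝓘(ℝ, E) f x A)
    (hg : HasCoordDerivAt IM 𝓘(ℝ, E) g x B) (hf1 : f x = 1) (hg1 : g x = 1) :
    HasCoordDerivAt IM 𝓘(ℝ, E) (fun y => f y * g y) x (A + B) := by
  have := hasCoordDerivAt_mul_one_one.comp x (hf.prodMk hg) (by rw [hf1, hg1])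
  refine this.congr_deriv ?_
  ext v
  simp

theorem HasLogDerivAt.congr_deriv (h : HasLogDerivAt IM f x A) (hB : A = B) :
    HasLogDerivAt IM f x B := hB ▸ h

theorem HasLogDerivAt.unique (h : HasLogDerivAt IM f x A) (h' : HasLogDerivAt IM f x B) : A = B :=
  HasCoordDerivAt.unique h h'

theorem exists_hasLogDerivAt (h : MDifferentiableAt IM 𝓘(ℝ, E) f x) :
    ∃ A : EM →L[ℝ] E, HasLogDerivAt IM f x A := by
  have h1 : MDifferentiableAt 𝓘(ℝ, E) 𝓘(ℝ, E) (fun z : G => (f x)⁻¹ * z) (f x) :=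
    (contMDiff_mul_left (I := 𝓘(ℝ, E)) (n := ∞)).mdifferentiable (by simp) _
  exact ⟨_, (h1.comp x h).hasCoordDerivAt⟩

theorem HasLogDerivAt.congr (h : HasLogDerivAt IM f x A) (hg : g =ᶠ[𝓝 x] f) :
    HasLogDerivAt IM g x A := by
  refine HasCoordDerivAt.congr h ?_
  filter_upwards [hg] with y hy
  rw [hy, hg.self_of_nhds]

theorem hasLogDerivAt_const (c : G) : HasLogDerivAt (E := E) IM (fun _ : M => c) x 0 :=
  hasCoordDerivAt_const _

theorem HasLogDerivAt.mul (hf : HasLogDerivAt IM f x A) (hg : HasLogDerivAt IM g x B) :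
    HasLogDerivAt IM (fun y => f y * g y) x (adjointRep (g x)⁻¹ ∘L A + B) := by
  have h1 := (hasCoordDerivAt_conj (g x)⁻¹).comp x hf (by simp)
  have h2 := h1.mul_of_eq_one hg (by simp) (by simp)
  refine HasCoordDerivAt.congr h2 (Eventually.of_forall fun y => ?_)
  simp only []
  group

theorem HasLogDerivAt.const_mul (c : G) (hf : HasLogDerivAt IM f x A) :
    HasLogDerivAt IM (fun y => c * f y) x A := by
  simpa using (hasLogDerivAt_const (E := E) (IM := IM) c).mul hf

theorem HasLogDerivAt.inv (hf : HasLogDerivAt IM f x A)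
    (hfd : MDifferentiableAt IM 𝓘(ℝ, E) f x) :
    HasLogDerivAt IM (fun y => (f y)⁻¹) x (-(adjointRep (f x) ∘L A)) := by
  have h1 : MDifferentiableAt 𝓘(ℝ, E) 𝓘(ℝ, E) (fun z : G => z⁻¹) (f x) :=
    (contMDiff_inv 𝓘(ℝ, E) ∞).mdifferentiable (by simp) _
  obtain ⟨B, hB⟩ := exists_hasLogDerivAt (h1.comp x hfd)
  have hB' : HasLogDerivAt IM (fun y => (f y)⁻¹) x B := hB
  refine hB'.congr_deriv ?_
  have h2 := hf.mul hB'
  simp only [mul_inv_cancel, inv_inv] at h2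
  exact (neg_eq_of_add_eq_zero_right (h2.unique (hasLogDerivAt_const 1))).symm

/-- A map is recovered to first order from its logarithmic derivative; in particular its derivative
vanishes when its logarithmic derivative does. -/
theorem HasLogDerivAt.hasCoordDerivAt_zero (hf : HasLogDerivAt (E := E) IM f x 0) :
    HasCoordDerivAt IM 𝓘(ℝ, E) f x 0 := by
  have h1 : MDifferentiableAt 𝓘(ℝ, E) 𝓘(ℝ, E) (fun z : G => f x * z) 1 :=
    (contMDiff_mul_left (I := 𝓘(ℝ, E)) (n := ∞)).mdifferentiable (by simp) _
  have h2 := h1.hasCoordDerivAt.comp x hf (by simp)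
  simpa using h2

variable {EL : Type*} [NormedAddCommGroup EL] [NormedSpace ℝ EL]
  {L : Type*} [TopologicalSpace L] [ChartedSpace EL L] [Group L] [LieGroup 𝓘(ℝ, EL) ∞ L]

theorem HasLogDerivAt.monoidHom_comp {ι : L →* G} {ι' : EL →L[ℝ] E} {p : M → L}
    {A : EM →L[ℝ] EL} (hι : HasCoordDerivAt 𝓘(ℝ, EL) 𝓘(ℝ, E) ι 1 ι')
    (hp : HasLogDerivAt IM p x A) :
    HasLogDerivAt IM (fun y => ι (p y)) x (ι' ∘L A) := by
  have := hι.comp x hp (by simp)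
  simpa [HasLogDerivAt] using this

end LogDeriv

section Ad

variable (E G)

/-- The preferred chart of `G` at `1`. -/
noncomputable def oneChart : G → E := extChartAt 𝓘(ℝ, E) (1 : G)

/-- The inverse of the preferred chart of `G` at `1`. -/
noncomputable def oneChartInv : E → G := (extChartAt 𝓘(ℝ, E) (1 : G)).symm

/-- The point that represents `1` in the preferred chart of `G` at `1`. -/
noncomputable def chartOne : E := oneChart E G 1

@[simp] theorem oneChart_one : oneChart E G 1 = chartOne E G := rfl

@[simp] theorem oneChartInv_chartOne : oneChartInv E G (chartOne E G) = 1 :=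
  extChartAt_to_inv 1

theorem hasCoordDerivAt_oneChart :
    HasCoordDerivAt 𝓘(ℝ, E) 𝓘(ℝ, E) (oneChart E G) 1 (ContinuousLinearMap.id ℝ E) :=
  hasCoordDerivAt_extChartAt (I := 𝓘(ℝ, E)) (1 : G)

theorem hasCoordDerivAt_oneChartInv :
    HasCoordDerivAt 𝓘(ℝ, E) 𝓘(ℝ, E) (oneChartInv E G) (chartOne E G)
      (ContinuousLinearMap.id ℝ E) :=
  hasCoordDerivAt_extChartAt_symm (I := 𝓘(ℝ, E)) (1 : G)

theorem eventually_oneChartInv : ∀ᶠ x in 𝓝 (chartOne E G),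
    ContMDiffAt 𝓘(ℝ, E) 𝓘(ℝ, E) ∞ (oneChartInv E G) x ∧
    ContMDiffAt 𝓘(ℝ, E) 𝓘(ℝ, E) ∞ (oneChart E G) (oneChartInv E G x) ∧
    x ∈ (extChartAt 𝓘(ℝ, E) (1 : G)).target := by
  have ho := isOpen_extChartAt_target (I := 𝓘(ℝ, E)) (1 : G)
  filter_upwards [ho.mem_nhds (mem_extChartAt_target 1)] with x hx
  refine ⟨(contMDiffOn_extChartAt_symm (1 : G)).contMDiffAt (ho.mem_nhds hx), ?_, hx⟩
  exact (extChartDiffeo 𝓘(ℝ, E) (1 : G)).contMDiffOn.contMDiffAt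
    ((isOpen_extChartAt_source (1 : G)).mem_nhds ((extChartAt 𝓘(ℝ, E) (1 : G)).map_target hx))

theorem contMDiffAt_oneChartInv :
    ContMDiffAt 𝓘(ℝ, E) 𝓘(ℝ, E) ∞ (oneChartInv E G) (chartOne E G) :=
  (eventually_oneChartInv E G).self_of_nhds.1

theorem contMDiffAt_oneChart : ContMDiffAt 𝓘(ℝ, E) 𝓘(ℝ, E) ∞ (oneChart E G) 1 :=
  contMDiffAt_extChartAt

theorem eventually_oneChart : ∀ᶠ g in 𝓝 (1 : G), oneChartInv E G (oneChart E G g) = g := by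
  filter_upwards [extChartAt_source_mem_nhds (I := 𝓘(ℝ, E)) (1 : G)] with g hg
  exact (extChartAt 𝓘(ℝ, E) (1 : G)).left_inv hg

/-- The multiplication of `G` near `1`, read in the preferred chart at `1`. -/
noncomputable def chartMul (p : E × E) : E :=
  oneChart E G (oneChartInv E G p.1 * oneChartInv E G p.2)

variable {E G}

theorem contDiffAt_chartMul {p : E × E}
    (h1 : ContMDiffAt 𝓘(ℝ, E) 𝓘(ℝ, E) ∞ (oneChartInv E G) p.1)
    (h2 : ContMDiffAt 𝓘(ℝ, E) 𝓘(ℝ, E) ∞ (oneChartInv E G) p.2)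
    (h : ContMDiffAt 𝓘(ℝ, E) 𝓘(ℝ, E) ∞ (oneChart E G)
      (oneChartInv E G p.1 * oneChartInv E G p.2)) : ContDiffAt ℝ ∞ (chartMul E G) p := by
  rw [← contMDiffAt_iff_contDiffAt]
  have e1 : ContMDiffAt 𝓘(ℝ, E × E) 𝓘(ℝ, E) ∞ (fun p : E × E => oneChartInv E G p.1) p :=
    h1.comp p contDiffAt_fst.contMDiffAt
  have e2 : ContMDiffAt 𝓘(ℝ, E × E) 𝓘(ℝ, E) ∞ (fun p : E × E => oneChartInv E G p.2) p :=
    h2.comp p contDiffAt_snd.contMDiffAt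
  exact ContMDiffAt.comp p h (e1.mul e2)

theorem eventually_contDiffAt_chartMul : ∀ᶠ x in 𝓝 (chartOne E G),
    ContDiffAt ℝ ∞ (chartMul E G) (chartOne E G, x) ∧
    ContDiffAt ℝ ∞ (chartMul E G) (x, chartOne E G) := by
  filter_upwards [eventually_oneChartInv E G] with x ⟨h1, h2, _⟩
  exact ⟨contDiffAt_chartMul (contMDiffAt_oneChartInv E G) h1 (by simpa using h2),
    contDiffAt_chartMul h1 (contMDiffAt_oneChartInv E G) (by simpa using h2)⟩

/-- The conjugation `(x, y) ↦ x y x⁻¹` near `1`, read in the preferred chart at `1`, is smooth. -/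
theorem contDiffAt_chartConj : ContDiffAt ℝ ∞ (fun p : E × E => oneChart E G
    (oneChartInv E G p.1 * oneChartInv E G p.2 * (oneChartInv E G p.1)⁻¹))
      (chartOne E G, chartOne E G) := by
  rw [← contMDiffAt_iff_contDiffAt]
  have h1 := contMDiffAt_oneChartInv E G
  have e1 : ContMDiffAt 𝓘(ℝ, E × E) 𝓘(ℝ, E) ∞ (fun p : E × E => oneChartInv E G p.1)
      (chartOne E G, chartOne E G) :=
    ContMDiffAt.comp (chartOne E G, chartOne E G) h1 contDiffAt_fst.contMDiffAt
  have e2 : ContMDiffAt 𝓘(ℝ, E × E) 𝓘(ℝ, E) ∞ (fun p : E × E => oneChartInv E G p.2)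
      (chartOne E G, chartOne E G) :=
    ContMDiffAt.comp (chartOne E G, chartOne E G) h1 contDiffAt_snd.contMDiffAt
  exact ContMDiffAt.comp (chartOne E G, chartOne E G) (g := oneChart E G)
    (by simpa using contMDiffAt_oneChart E G) ((e1.mul e2).mul e1.inv)

theorem adjointRep_eq_fderiv (g : G) : adjointRep g = fderiv ℝ (fun y => oneChart E G
    (g * oneChartInv E G y * g⁻¹)) (chartOne E G) := by
  have h1 := (hasCoordDerivAt_oneChart E G).comp (chartOne E G)
    ((hasCoordDerivAt_conj g).comp (chartOne E G)
    (hasCoordDerivAt_oneChartInv E G) (by simp)) (by simp)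
  rw [(hasCoordDerivAt_iff_hasFDerivAt.1 h1).fderiv]
  ext; simp

theorem contDiffAt_adjointRep_chart :
    ContDiffAt ℝ ∞ (fun x => adjointRep (E := E) (oneChartInv E G x)) (chartOne E G) := by
  simp only [adjointRep_eq_fderiv]
  exact ContDiffAt.fderiv (n := ∞) (contDiffAt_chartConj (E := E) (G := G)) contDiffAt_const
    (by simp)

/-- The derivative at `y = 1` of `(x, y) ↦ x y`, i.e. the left invariant vector fields, in the
preferred chart at `1`. -/
theorem hasFDerivAt_chartMul_right {x : E}
    (h : ContDiffAt ℝ ∞ (chartMul E G) (x, chartOne E G)) :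
    HasFDerivAt (fun y => chartMul E G (x, y))
      (fderiv ℝ (chartMul E G) (x, chartOne E G) ∘L ContinuousLinearMap.inr ℝ E E)
      (chartOne E G) :=
  (h.differentiableAt (by simp)).hasFDerivAt.comp (chartOne E G)
    (hasFDerivAt_prodMk_right x (chartOne E G))

theorem hasFDerivAt_chartMul_left {x : E}
    (h : ContDiffAt ℝ ∞ (chartMul E G) (chartOne E G, x)) :
    HasFDerivAt (fun y => chartMul E G (y, x))
      (fderiv ℝ (chartMul E G) (chartOne E G, x) ∘L ContinuousLinearMap.inl ℝ E E)
      (chartOne E G) :=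
  HasFDerivAt.comp (f := fun y => (y, x)) (chartOne E G)
    (h.differentiableAt (by simp)).hasFDerivAt (hasFDerivAt_prodMk_left (chartOne E G) x)

/-- Left invariant vector fields are right translated by `Ad`: in the chart at `1`, this is obtained
by differentiating `(x y x⁻¹) x = x y` at `y = 1`. -/
theorem eventually_chartMul_adjointRep : ∀ᶠ x in 𝓝 (chartOne E G),
    (fderiv ℝ (chartMul E G) (chartOne E G, x) ∘L ContinuousLinearMap.inl ℝ E E) ∘L
      adjointRep (oneChartInv E G x) =
    fderiv ℝ (chartMul E G) (x, chartOne E G) ∘L ContinuousLinearMap.inr ℝ E E := by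
  filter_upwards [eventually_contDiffAt_chartMul (E := E) (G := G)] with x ⟨hl, hr⟩
  set g := oneChartInv E G x
  have h1 : HasCoordDerivAt 𝓘(ℝ, E) 𝓘(ℝ, E)
      (fun y => oneChart E G (g * oneChartInv E G y * g⁻¹)) (chartOne E G) (adjointRep g) :=
    ((hasCoordDerivAt_oneChart E G).comp (chartOne E G)
      ((hasCoordDerivAt_conj g).comp (chartOne E G)
      (hasCoordDerivAt_oneChartInv E G) (by simp)) (by simp)).congr_deriv (by ext; simp)
  have h2 := (hasCoordDerivAt_iff_hasFDerivAt.2 (hasFDerivAt_chartMul_left hl)).comp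
    (chartOne E G) h1 (by simp)
  refine h2.unique ?_
  refine (hasCoordDerivAt_iff_hasFDerivAt.2 (hasFDerivAt_chartMul_right hr)).congr ?_
  have hc : ContinuousAt (fun y => g * oneChartInv E G y * g⁻¹) (chartOne E G) :=
    ((hasCoordDerivAt_conj g).comp (chartOne E G)
      (hasCoordDerivAt_oneChartInv E G) (by simp)).mdifferentiableAt.continuousAt
  have hc' := hc.eventually (p := fun z => oneChartInv E G (oneChart E G z) = z)
    (by simpa using eventually_oneChart E G)
  filter_upwards [hc'] with y hy
  simp only [chartMul, hy]
  change oneChart E G (g * oneChartInv E G y * g⁻¹ * g) = oneChart E G (g * oneChartInv E G y)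
  simp

/-- The derivative of `Ad` at `1`, in terms of the second derivative of the multiplication; it is
obtained by differentiating `eventually_chartMul_adjointRep` at `1`. -/
theorem fderiv_adjointRep_chart (X Y : E) :
    fderiv ℝ (fun x => adjointRep (E := E) (oneChartInv E G x)) (chartOne E G) X Y =
      fderiv ℝ (fderiv ℝ (chartMul E G)) (chartOne E G, chartOne E G) (X, 0) (0, Y) -
      fderiv ℝ (fderiv ℝ (chartMul E G)) (chartOne E G, chartOne E G) (0, X) (Y, 0) := by
  set o := chartOne E G
  have hm : ContDiffAt ℝ ∞ (chartMul E G) (o, o) :=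
    (eventually_contDiffAt_chartMul (E := E) (G := G)).self_of_nhds.1
  have hd : DifferentiableAt ℝ (fderiv ℝ (chartMul E G)) (o, o) :=
    (hm.fderiv_right (m := 1) (by norm_cast)).differentiableAt (by simp)
  have hl : HasFDerivAt (fun x => fderiv ℝ (chartMul E G) (o, x))
      (fderiv ℝ (fderiv ℝ (chartMul E G)) (o, o) ∘L ContinuousLinearMap.inr ℝ E E) o :=
    hd.hasFDerivAt.comp o (hasFDerivAt_prodMk_right o o)
  have hr : HasFDerivAt (fun x => fderiv ℝ (chartMul E G) (x, o))
      (fderiv ℝ (fderiv ℝ (chartMul E G)) (o, o) ∘L ContinuousLinearMap.inl ℝ E E) o :=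
    HasFDerivAt.comp (f := fun x => (x, o)) o hd.hasFDerivAt (hasFDerivAt_prodMk_left o o)
  have ha : HasFDerivAt (fun x => adjointRep (E := E) (oneChartInv E G x)) _ o :=
    ((contDiffAt_adjointRep_chart (E := E) (G := G)).differentiableAt (by simp)).hasFDerivAt
  have h1 := (hl.clm_comp (hasFDerivAt_const (ContinuousLinearMap.inl ℝ E E) o)).clm_comp ha
  have h2 := hr.clm_comp (hasFDerivAt_const (ContinuousLinearMap.inr ℝ E E) o)
  have h3 := h1.congr_of_eventuallyEq
    ((eventually_chartMul_adjointRep (E := E) (G := G)).mono fun x hx => hx.symm)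
  have h4 := DFunLike.congr_fun (DFunLike.congr_fun (h3.unique h2) X) Y
  have h5 : fderiv ℝ (chartMul E G) (o, o) ∘L ContinuousLinearMap.inl ℝ E E =
      ContinuousLinearMap.id ℝ E := by
    have := (hasFDerivAt_chartMul_left hm)
    refine this.unique ?_
    refine (hasFDerivAt_id _).congr_of_eventuallyEq ?_
    filter_upwards [eventually_oneChartInv E G] with x hx
    simp only [chartMul, o, oneChartInv_chartOne, mul_one]
    exact (extChartAt 𝓘(ℝ, E) (1 : G)).right_inv hx.2.2
  rw [h5] at h4
  simp [o] at h4
  rw [eq_sub_iff_add_eq, ← h4]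

/-- The left invariant vector fields, read in the preferred chart at `1`. -/
theorem mpullbackWithin_mulInvariantVectorField_oneChartInv
    (Y : GroupLieAlgebra 𝓘(ℝ, E) G) : ∀ᶠ x in 𝓝 (chartOne E G),
    VectorField.mpullbackWithin 𝓘(ℝ, E) 𝓘(ℝ, E) (oneChartInv E G) (mulInvariantVectorField Y)
      (range 𝓘(ℝ, E)) x = fderiv ℝ (chartMul E G) (x, chartOne E G) ((0, Y) : E × E) := by
  filter_upwards [eventually_contDiffAt_chartMul (E := E) (G := G), eventually_oneChartInv E G]
    with x ⟨_, hr⟩ ⟨h1, h2, h3⟩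
  have a1 := (h1.mdifferentiableAt (by simp)).hasCoordDerivAt
  have a2 := (h2.mdifferentiableAt (by simp)).hasCoordDerivAt
  have a3 : MDifferentiableAt 𝓘(ℝ, E) 𝓘(ℝ, E) (fun z : G => oneChartInv E G x * z) 1 :=
    (contMDiff_mul_left (I := 𝓘(ℝ, E)) (n := ∞)).mdifferentiable (by simp) _
  have h4 := a2.comp (chartOne E G) (a3.hasCoordDerivAt.comp (chartOne E G)
    (hasCoordDerivAt_oneChartInv E G) (by simp)) (by simp)
  have h5 := (hasCoordDerivAt_iff_hasFDerivAt.1 h4).unique (hasFDerivAt_chartMul_right hr)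
  have hid : coordDeriv 𝓘(ℝ, E) 𝓘(ℝ, E) (oneChart E G) (oneChartInv E G x) ∘L
      coordDeriv 𝓘(ℝ, E) 𝓘(ℝ, E) (oneChartInv E G) x = ContinuousLinearMap.id ℝ E := by
    refine (a2.comp x a1 rfl).unique (hasCoordDerivAt_id.congr ?_)
    filter_upwards [(isOpen_extChartAt_target (I := 𝓘(ℝ, E)) (1 : G)).mem_nhds h3] with y hy
    exact (extChartAt 𝓘(ℝ, E) (1 : G)).right_inv hy
  have hid2 : coordDeriv 𝓘(ℝ, E) 𝓘(ℝ, E) (oneChartInv E G) x ∘L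
      coordDeriv 𝓘(ℝ, E) 𝓘(ℝ, E) (oneChart E G) (oneChartInv E G x) =
        ContinuousLinearMap.id ℝ E := by
    have hx : oneChart E G (oneChartInv E G x) = x := (extChartAt 𝓘(ℝ, E) (1 : G)).right_inv h3
    refine (a1.comp (oneChartInv E G x) a2 hx).unique (hasCoordDerivAt_id.congr ?_)
    filter_upwards [(isOpen_extChartAt_source (I := 𝓘(ℝ, E)) (1 : G)).mem_nhds
      ((extChartAt 𝓘(ℝ, E) (1 : G)).map_target h3)] with y hy
    exact (extChartAt 𝓘(ℝ, E) (1 : G)).left_inv hy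
  have h6 : (coordDeriv 𝓘(ℝ, E) 𝓘(ℝ, E) (oneChartInv E G) x).inverse =
      coordDeriv 𝓘(ℝ, E) 𝓘(ℝ, E) (oneChart E G) (oneChartInv E G x) :=
    ContinuousLinearMap.inverse_eq hid2 hid
  have h7 : VectorField.mpullbackWithin 𝓘(ℝ, E) 𝓘(ℝ, E) (oneChartInv E G)
      (mulInvariantVectorField Y) (range 𝓘(ℝ, E)) x =
      (coordDeriv 𝓘(ℝ, E) 𝓘(ℝ, E) (oneChartInv E G) x).inverse
        (coordDeriv 𝓘(ℝ, E) 𝓘(ℝ, E) (fun z : G => oneChartInv E G x * z) 1 Y) := by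
    rw [ModelWithCorners.Boundaryless.range_eq_univ, VectorField.mpullbackWithin_univ]
    rfl
  rw [h7, h6]
  exact (DFunLike.congr_fun h5 (Y : E))

/-- The derivative of `Ad` at `1` is the bracket: both are the antisymmetrization of the mixed
second derivative of the multiplication at `1`. -/
theorem fderiv_adjointRep_eq_lie [FiniteDimensional ℝ E] (X Y : GroupLieAlgebra 𝓘(ℝ, E) G) :
    fderiv ℝ (fun x => adjointRep (E := E) (oneChartInv E G x)) (chartOne E G) (X : E) (Y : E) =
      (⁅X, Y⁆ : GroupLieAlgebra 𝓘(ℝ, E) G) := by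
  have hm : ContDiffAt ℝ ∞ (chartMul E G) (chartOne E G, chartOne E G) :=
    (eventually_contDiffAt_chartMul (E := E) (G := G)).self_of_nhds.1
  have hd : DifferentiableAt ℝ (fderiv ℝ (chartMul E G)) (chartOne E G, chartOne E G) :=
    (hm.fderiv_right (m := 1) (by norm_cast)).differentiableAt (by simp)
  have hr : HasFDerivAt (fun x => fderiv ℝ (chartMul E G) (x, chartOne E G))
      (fderiv ℝ (fderiv ℝ (chartMul E G)) (chartOne E G, chartOne E G) ∘L
        ContinuousLinearMap.inl ℝ E E) (chartOne E G) :=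
    HasFDerivAt.comp (f := fun x => (x, chartOne E G)) (chartOne E G) hd.hasFDerivAt
      (hasFDerivAt_prodMk_left _ _)
  have hr' (Z : E) : fderiv ℝ (fun x => fderiv ℝ (chartMul E G) (x, chartOne E G) (0, Z))
      (chartOne E G) = (fderiv ℝ (fderiv ℝ (chartMul E G)) (chartOne E G, chartOne E G) ∘L
        ContinuousLinearMap.inl ℝ E E).flip (0, Z) := by
    refine HasFDerivAt.fderiv ?_
    simpa using hr.clm_apply (hasFDerivAt_const ((0, Z) : E × E) (chartOne E G))
  have hsymm (X Y : E) :
      fderiv ℝ (fderiv ℝ (chartMul E G)) (chartOne E G, chartOne E G) (0, X) (Y, 0) =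
      fderiv ℝ (fderiv ℝ (chartMul E G)) (chartOne E G, chartOne E G) (Y, 0) (0, X) :=
    (hm.isSymmSndFDerivAt (by simp; exact WithTop.coe_le_coe.2 le_top)) _ _
  have hm1 : fderiv ℝ (chartMul E G) (chartOne E G, chartOne E G) ∘L
      ContinuousLinearMap.inr ℝ E E = ContinuousLinearMap.id ℝ E := by
    refine (hasFDerivAt_chartMul_right hm).unique ?_
    refine (hasFDerivAt_id _).congr_of_eventuallyEq ?_
    filter_upwards [eventually_oneChartInv E G] with x hx
    simp only [chartMul, oneChartInv_chartOne, one_mul]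
    exact (extChartAt 𝓘(ℝ, E) (1 : G)).right_inv hx.2.2
  have hid : coordDeriv 𝓘(ℝ, E) 𝓘(ℝ, E) (oneChart E G) 1 = ContinuousLinearMap.id ℝ E :=
    (hasCoordDerivAt_oneChart E G).coordDeriv_eq
  let V (Z : E) : E → E := VectorField.mpullbackWithin 𝓘(ℝ, E) 𝓘(ℝ, E) (oneChartInv E G)
    (mulInvariantVectorField (I := 𝓘(ℝ, E)) (G := G) Z) (range 𝓘(ℝ, E))
  have hV (Z : E) : V Z =ᶠ[𝓝 (chartOne E G)]
      fun x => fderiv ℝ (chartMul E G) (x, chartOne E G) ((0, Z) : E × E) :=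
    mpullbackWithin_mulInvariantVectorField_oneChartInv Z
  have hV1 (Z : E) : V Z (chartOne E G) = Z :=
    (hV Z).self_of_nhds.trans (DFunLike.congr_fun hm1 Z)
  have hb : (⁅X, Y⁆ : GroupLieAlgebra 𝓘(ℝ, E) G) =
      VectorField.lieBracket ℝ (V X) (V Y) (chartOne E G) := by
    have h1 : (⁅X, Y⁆ : GroupLieAlgebra 𝓘(ℝ, E) G) =
      (coordDeriv 𝓘(ℝ, E) 𝓘(ℝ, E) (oneChart E G) 1).inverse
        (VectorField.lieBracketWithin ℝ (V X) (V Y)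
          (oneChartInv E G ⁻¹' univ ∩ range 𝓘(ℝ, E)) (chartOne E G)) := rfl
    rw [h1, hid, ModelWithCorners.Boundaryless.range_eq_univ, preimage_univ, inter_univ,
      VectorField.lieBracketWithin_univ, ContinuousLinearMap.inverse_id]
    rfl
  have key (X Y : E) : VectorField.lieBracket ℝ (V X) (V Y) (chartOne E G) =
      fderiv ℝ (fun x => adjointRep (E := E) (oneChartInv E G x)) (chartOne E G) X Y := by
    rw [VectorField.lieBracket, (hV X).fderiv_eq, (hV Y).fderiv_eq, hV1, hV1, hr', hr',
      fderiv_adjointRep_chart, hsymm]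
    rfl
  exact (key X Y).symm.trans hb.symm

/-- The bracket of the Lie algebra of `G`, as a bilinear map of the model space. -/
noncomputable def modelBracket (E G : Type*) [NormedAddCommGroup E] [NormedSpace ℝ E]
    [TopologicalSpace G] [ChartedSpace E G] [Group G] : E →L[ℝ] E →L[ℝ] E :=
  fderiv ℝ (fun x => adjointRep (E := E) (oneChartInv E G x)) (chartOne E G)

theorem modelBracket_apply [FiniteDimensional ℝ E] (X Y : GroupLieAlgebra 𝓘(ℝ, E) G) :
    modelBracket E G (X : E) (Y : E) = (⁅X, Y⁆ : GroupLieAlgebra 𝓘(ℝ, E) G) :=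
  fderiv_adjointRep_eq_lie X Y

theorem hasCoordDerivAt_adjointRep_one :
    HasCoordDerivAt 𝓘(ℝ, E) 𝓘(ℝ, E →L[ℝ] E) (fun g : G => adjointRep (E := E) g) 1
      (modelBracket E G) := by
  have h1 : HasCoordDerivAt 𝓘(ℝ, E) 𝓘(ℝ, E →L[ℝ] E)
      (fun x => adjointRep (E := E) (oneChartInv E G x)) (chartOne E G) (modelBracket E G) :=
    hasCoordDerivAt_iff_hasFDerivAt.2
      ((contDiffAt_adjointRep_chart (E := E) (G := G)).differentiableAt (by simp)).hasFDerivAt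
  have h2 := (h1.comp (1 : G) (hasCoordDerivAt_oneChart E G) (by simp)).congr
    (g := fun g : G => adjointRep (E := E) g) (by
      filter_upwards [eventually_oneChart E G] with g hg
      rw [hg])
  exact h2

/-- The derivative of `Ad ∘ f` is `v ↦ Ad(f(x)) ∘ ad(A v)`, for `A` the logarithmic derivative
of `f`. -/
theorem HasLogDerivAt.adjointRep {f : M → G} {x : M} {A : EM →L[ℝ] E}
    (hf : HasLogDerivAt IM f x A) :
    HasCoordDerivAt IM 𝓘(ℝ, E →L[ℝ] E) (fun y => adjointRep (E := E) (f y)) x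
      (ContinuousLinearMap.compL ℝ E E E (adjointRep (f x)) ∘L modelBracket E G ∘L A) := by
  have h1 := (hasCoordDerivAt_adjointRep_one (E := E) (G := G)).comp x hf (by simp)
  have h2 := (hasCoordDerivAt_iff_hasFDerivAt.2 (ContinuousLinearMap.hasFDerivAt
    (ContinuousLinearMap.compL ℝ E E E (_root_.adjointRep (f x))))).comp x h1 rfl
  refine h2.congr (Eventually.of_forall fun y => ?_)
  simp only [ContinuousLinearMap.compL_apply, ← adjointRep_mul, mul_inv_cancel_left]

end Ad

end LieGroupCalculus

/-! ### Invariance of ideals under the adjoint representation -/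

section AdjointInvariance

variable {E : Type*} [NormedAddCommGroup E] [NormedSpace ℝ E] [FiniteDimensional ℝ E]
  {G : Type*} [TopologicalSpace G] [ChartedSpace E G] [Group G] [LieGroup 𝓘(ℝ, E) ∞ G]

/-- A subgroup of a connected topological group that is a neighborhood of `1` is everything. -/
theorem Subgroup.eq_top_of_mem_nhds_one {G : Type*} [TopologicalSpace G] [Group G]
    [IsTopologicalGroup G] [ConnectedSpace G] (H : Subgroup G) (hH : (H : Set G) ∈ 𝓝 1) :
    H = ⊤ := by
  have ho := H.isOpen_of_mem_nhds hH
  exact SetLike.coe_injective (IsClopen.eq_univ ⟨H.isClosed_of_isOpen ho, ho⟩ ⟨1, H.one_mem⟩)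

/-- A subspace of a finite-dimensional space is the kernel of a projection. -/
theorem exists_clm_eq_zero_iff_mem (V : Submodule ℝ E) :
    ∃ π : E →L[ℝ] E, (∀ y, π y = 0 ↔ y ∈ V) ∧ ∀ y, y - π y ∈ V := by
  obtain ⟨W, hW⟩ := V.exists_isCompl
  let π := (W.subtype ∘ₗ W.projectionOnto V hW.symm : E →ₗ[ℝ] E)
  refine ⟨π.toContinuousLinearMap, fun y => ?_, fun y => ?_⟩
  · change ((W.projectionOnto V hW.symm y : W) : E) = 0 ↔ _
    rw [ZeroMemClass.coe_eq_zero, Submodule.projectionOnto_apply_eq_zero_iff]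
  · have h : W.projectionOnto V hW.symm (y - W.projectionOnto V hW.symm y) = 0 := by
      rw [map_sub, Submodule.projectionOnto_apply_left, sub_self]
    exact (Submodule.projectionOnto_apply_eq_zero_iff hW.symm).1 h

theorem exists_eventually_norm_fderiv_le {F F' : Type*} [NormedAddCommGroup F] [NormedSpace ℝ F]
    [NormedAddCommGroup F'] [NormedSpace ℝ F'] {α : F → F'} {o : F} (h : ContDiffAt ℝ ∞ α o) :
    ∃ C : ℝ, ∀ᶠ x in 𝓝 o, ∀ v, ‖fderiv ℝ α x v‖ ≤ C * ‖v‖ := by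
  have hc : ContinuousAt (fderiv ℝ α) o := (h.fderiv_right (m := 0) (by simp)).continuousAt
  refine ⟨‖fderiv ℝ α o‖ + 1,
    (hc.norm.tendsto.eventually_lt_const (lt_add_one _)).mono fun x hx v => ?_⟩
  exact ((fderiv ℝ α x).le_opNorm v).trans (by gcongr)

/-- The differential equation for `Ad`, in the chart at `1`. -/
theorem eventually_hasFDerivAt_adjointRep_chart : ∀ᶠ x in 𝓝 (chartOne E G),
    ∃ A : E →L[ℝ] E, HasFDerivAt (fun x => adjointRep (E := E) (oneChartInv E G x))
      (ContinuousLinearMap.compL ℝ E E E (adjointRep (oneChartInv E G x)) ∘L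
        modelBracket E G ∘L A) x := by
  filter_upwards [eventually_oneChartInv E G] with x hx
  obtain ⟨A, hA⟩ := exists_hasLogDerivAt (hx.1.mdifferentiableAt (by simp))
  exact ⟨A, hasCoordDerivAt_iff_hasFDerivAt.1 hA.adjointRep⟩

/-- If `V` is stable under the brackets with all of the Lie algebra, then it is stable under `Ad g`
for `g` near `1`: along a segment in the chart, the part of `Ad` that maps `V` to a complement
satisfies a homogeneous linear differential equation. -/
theorem eventually_adjointRep_mem {V : Submodule ℝ E}
    (hV : ∀ X, ∀ Y ∈ V, modelBracket E G X Y ∈ V) :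
    ∀ᶠ x in 𝓝 (chartOne E G), ∀ Y ∈ V, adjointRep (oneChartInv E G x) Y ∈ V := by
  have : IsTopologicalGroup G := topologicalGroup_of_lieGroup 𝓘(ℝ, E) ∞
  set o := chartOne E G
  set α : E → E →L[ℝ] E := fun x => adjointRep (E := E) (oneChartInv E G x) with hα
  have hαc : ContDiffAt ℝ ∞ α o := contDiffAt_adjointRep_chart
  have hc2 : ContinuousAt (fun x => adjointRep (E := E) (oneChartInv E G x)⁻¹) o := by
    have h1 : ContinuousAt (fun x => (oneChartInv E G x)⁻¹) o :=
      (contMDiffAt_oneChartInv E G).continuousAt.inv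
    have h2 : ContinuousAt (fun g : G => adjointRep (E := E) g) 1 :=
      hasCoordDerivAt_adjointRep_one.mdifferentiableAt.continuousAt
    exact ContinuousAt.comp (f := fun x => (oneChartInv E G x)⁻¹) (by simpa [o] using h2) h1
  obtain ⟨C1, hC1⟩ := exists_eventually_norm_fderiv_le hαc
  obtain ⟨C2, hC2⟩ : ∃ C, ∀ᶠ x in 𝓝 o, ‖adjointRep (E := E) (oneChartInv E G x)⁻¹‖ < C :=
    ⟨_, (ContinuousAt.tendsto hc2).norm.eventually_lt_const (lt_add_one _)⟩
  obtain ⟨ε, hε, hball⟩ := Metric.eventually_nhds_iff_ball.1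
    (hC1.and (hC2.and (eventually_hasFDerivAt_adjointRep_chart (E := E) (G := G))))
  obtain ⟨π, hπ, hπ'⟩ := exists_clm_eq_zero_iff_mem V
  set ρ : E →L[ℝ] E := ContinuousLinearMap.id ℝ E - π with hρ
  filter_upwards [Metric.ball_mem_nhds o hε] with x hx Y hY
  have hseg : ∀ t ∈ Icc (0 : ℝ) 1, o + t • (x - o) ∈ Metric.ball o ε := fun t ht =>
    (convex_ball o ε).add_smul_sub_mem (Metric.mem_ball_self hε) hx ht
  -- `ρ` is a projection onto `V`, with kernel the image of `π`.
  let Q : ℝ → E →L[ℝ] E := fun t => π ∘L α (o + t • (x - o)) ∘L ρ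
  let Q' : ℝ → E →L[ℝ] E := fun t => π ∘L fderiv ℝ α (o + t • (x - o)) (x - o) ∘L ρ
  have hderiv : ∀ t ∈ Icc (0 : ℝ) 1, HasDerivAt Q (Q' t) t := by
    intro t ht
    obtain ⟨_, _, A, hA⟩ := hball _ (hseg t ht)
    have h1 : HasDerivAt (fun t : ℝ => o + t • (x - o)) (x - o) t := by
      simpa using ((hasDerivAt_id t).smul_const (x - o)).const_add o
    have h2 := hA.differentiableAt.hasFDerivAt.comp_hasDerivAt t h1
    exact (((ContinuousLinearMap.compL ℝ E E E).flip ρ).hasFDerivAt.comp_hasDerivAt t h2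
      |> fun h => (ContinuousLinearMap.compL ℝ E E E π).hasFDerivAt.comp_hasDerivAt t h)
  have hbound : ∀ t ∈ Icc (0 : ℝ) 1, ‖Q' t‖ ≤ (C2 * (C1 * ‖x - o‖) * ‖ρ‖) * ‖Q t‖ := by
    intro t ht
    obtain ⟨hb1, hb2, A, hA⟩ := hball _ (hseg t ht)
    set y := o + t • (x - o)
    set B : E →L[ℝ] E := modelBracket E G (A (x - o))
    have hd : fderiv ℝ α y (x - o) = α y ∘L B := by rw [hA.fderiv]; rfl
    have hB : B = adjointRep (oneChartInv E G y)⁻¹ ∘L fderiv ℝ α y (x - o) := by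
      rw [hd]
      ext v
      simp [hα]
    have hBn : ‖B‖ ≤ C2 * (C1 * ‖x - o‖) := by
      rw [hB]
      refine (ContinuousLinearMap.opNorm_comp_le _ _).trans ?_
      exact mul_le_mul hb2.le (hb1 _) (norm_nonneg _) ((norm_nonneg _).trans hb2.le)
    -- As `B` preserves `V`, the projection `ρ` may be inserted before it.
    have hQ : Q' t = Q t ∘L B ∘L ρ := by
      change π ∘L fderiv ℝ α y (x - o) ∘L ρ = (π ∘L α y ∘L ρ) ∘L B ∘L ρ
      rw [hd]
      ext v
      have h5 : ρ v ∈ V := hπ' v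
      have h6 : ρ (B (ρ v)) = B (ρ v) := by
        have := (hπ _).2 (hV (A (x - o)) _ h5)
        change B (ρ v) - π (B (ρ v)) = _
        rw [this, sub_zero]
      simp only [ContinuousLinearMap.comp_apply, h6]
    rw [hQ]
    calc ‖Q t ∘L B ∘L ρ‖ ≤ ‖Q t‖ * (‖B‖ * ‖ρ‖) :=
          (ContinuousLinearMap.opNorm_comp_le _ _).trans
            (mul_le_mul_of_nonneg_left (ContinuousLinearMap.opNorm_comp_le _ _) (norm_nonneg _))
      _ ≤ ‖Q t‖ * ((C2 * (C1 * ‖x - o‖)) * ‖ρ‖) := by gcongr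
      _ = _ := by ring
  have hQ0 : Q 0 = 0 := by
    ext v
    simp only [Q, zero_smul, add_zero, hα, o, oneChartInv_chartOne, adjointRep_one]
    exact (hπ _).2 (hπ' v)
  have hgron := norm_le_gronwallBound_of_norm_deriv_right_le (f := Q) (f' := Q') (δ := 0)
    (K := C2 * (C1 * ‖x - o‖) * ‖ρ‖) (ε := 0) (a := 0) (b := 1)
    (fun t ht => (hderiv t ht).continuousAt.continuousWithinAt)
    (fun t ht => (hderiv t ⟨ht.1, ht.2.le⟩).hasDerivWithinAt) (by rw [hQ0, norm_zero])
    (fun t ht => by simpa using hbound t ⟨ht.1, ht.2.le⟩) 1 (by simp)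
  have hQ1 : Q 1 = 0 := by
    rw [gronwallBound_ε0_δ0] at hgron
    exact norm_le_zero_iff.1 hgron
  have h7 := DFunLike.congr_fun hQ1 Y
  have hρY : ρ Y = Y := by
    change Y - π Y = Y
    rw [(hπ Y).2 hY, sub_zero]
  have h8 : π (α (o + (1 : ℝ) • (x - o)) (ρ Y)) = 0 := h7
  rw [hρY, one_smul, add_sub_cancel] at h8
  exact (hπ _).1 h8

/-- An ideal of the Lie algebra of a connected Lie group is stable under `Ad`. -/
theorem adjointRep_mem_of_ideal [ConnectedSpace G] {V : Submodule ℝ E}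
    (hV : ∀ X, ∀ Y ∈ V, modelBracket E G X Y ∈ V) (g : G) {Y : E} (hY : Y ∈ V) :
    adjointRep g Y ∈ V := by
  have : IsTopologicalGroup G := topologicalGroup_of_lieGroup 𝓘(ℝ, E) ∞
  let H : Subgroup G :=
    { carrier := {g | (∀ Y ∈ V, adjointRep g Y ∈ V) ∧ ∀ Y ∈ V, adjointRep g⁻¹ Y ∈ V}
      mul_mem' := by
        rintro a b ⟨h1, h2⟩ ⟨h3, h4⟩
        refine ⟨fun Y hY => ?_, fun Y hY => ?_⟩
        · rw [adjointRep_mul]; exact h1 _ (h3 _ hY)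
        · rw [mul_inv_rev, adjointRep_mul]; exact h4 _ (h2 _ hY)
      one_mem' := by simp
      inv_mem' := by
        rintro a ⟨h1, h2⟩
        exact ⟨h2, by simpa using h1⟩ }
  have h1 : ∀ᶠ g in 𝓝 (1 : G), ∀ Y ∈ V, adjointRep g Y ∈ V := by
    have hc : ContinuousAt (oneChart E G) 1 := (contMDiffAt_oneChart E G).continuousAt
    filter_upwards [eventually_oneChart E G, hc.eventually (eventually_adjointRep_mem hV)]
      with g hg h
    rwa [hg] at h
  have h2 : ∀ᶠ g in 𝓝 (1 : G), ∀ Y ∈ V, adjointRep g⁻¹ Y ∈ V :=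
    (continuous_inv.tendsto' (1 : G) 1 inv_one).eventually h1
  have h3 : (H : Set G) ∈ 𝓝 1 := h1.and h2
  have h4 : g ∈ H := by rw [H.eq_top_of_mem_nhds_one h3]; trivial
  exact h4.1 Y hY

variable {EL : Type*} [NormedAddCommGroup EL] [NormedSpace ℝ EL]
  {L : Type*} [TopologicalSpace L] [ChartedSpace EL L] [Group L] [LieGroup 𝓘(ℝ, EL) ∞ L]

/-- If `V` is an ideal and the connected group `L` is tangent to `V`, then `L` acts trivially on the
quotient by `V`. -/
theorem adjointRep_sub_mem_of_ideal [ConnectedSpace G] [ConnectedSpace L] {V : Submodule ℝ E}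
    (hV : ∀ X, ∀ Y ∈ V, modelBracket E G X Y ∈ V) (hV' : ∀ X ∈ V, ∀ Y, modelBracket E G X Y ∈ V)
    {ι : L →* G} {ι' : EL →L[ℝ] E} (hι : HasCoordDerivAt 𝓘(ℝ, EL) 𝓘(ℝ, E) ι 1 ι')
    (hι' : ∀ v, ι' v ∈ V) (l : L) (Y : E) : adjointRep (ι l) Y - Y ∈ V := by
  obtain ⟨π, hπ, hπ'⟩ := exists_clm_eq_zero_iff_mem V
  have hloc (l : L) : HasCoordDerivAt 𝓘(ℝ, EL) 𝓘(ℝ, E →L[ℝ] E)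
      (fun l => π ∘L adjointRep (E := E) (ι l)) l 0 := by
    obtain ⟨A, hA⟩ := exists_hasLogDerivAt (IM := 𝓘(ℝ, EL)) (f := fun l : L => l) (x := l)
      mdifferentiableAt_id
    have h1 := (hA.monoidHom_comp hι).adjointRep
    have h2 := (hasCoordDerivAt_iff_hasFDerivAt.2 (ContinuousLinearMap.hasFDerivAt
      (ContinuousLinearMap.compL ℝ E E E π))).comp l h1 rfl
    refine h2.congr_deriv ?_
    ext v Z
    exact (hπ _).2 (adjointRep_mem_of_ideal hV _ (hV' _ (hι' _) _))
  have hconst : IsLocallyConstant (fun l => π ∘L adjointRep (E := E) (ι l)) :=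
    (IsLocallyConstant.iff_eventually_eq _).2 fun l =>
      eventually_eq_of_mfderiv_eq_zero (Eventually.of_forall hloc)
  have h := DFunLike.congr_fun (hconst.apply_eq_of_preconnectedSpace l 1) Y
  simp only [map_one, adjointRep_one, ContinuousLinearMap.comp_apply,
    ContinuousLinearMap.id_apply] at h
  rw [← hπ, map_sub, h, sub_self]

end AdjointInvariance

/-! ### Immersed subgroups with complementary Lie algebras -/

section Transversal

variable {E : Type*} [NormedAddCommGroup E] [NormedSpace ℝ E] [FiniteDimensional ℝ E]
  {G : Type*} [TopologicalSpace G] [ChartedSpace E G] [Group G] [LieGroup 𝓘(ℝ, E) ∞ G]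
  {EU : Type*} [NormedAddCommGroup EU] [NormedSpace ℝ EU] [FiniteDimensional ℝ EU]
  {U : Type*} [TopologicalSpace U] [ChartedSpace EU U] [Group U] [LieGroup 𝓘(ℝ, EU) ∞ U]
  {EN : Type*} [NormedAddCommGroup EN] [NormedSpace ℝ EN] [FiniteDimensional ℝ EN]
  {N : Type*} [TopologicalSpace N] [ChartedSpace EN N] [Group N] [LieGroup 𝓘(ℝ, EN) ∞ N]
  {EM : Type*} [NormedAddCommGroup EM] [NormedSpace ℝ EM]
  {HM : Type*} [TopologicalSpace HM] {IM : ModelWithCorners ℝ EM HM} [IM.Boundaryless]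
  {M : Type*} [TopologicalSpace M] [ChartedSpace HM M] [IsManifold IM ∞ M]

/-- Two Lie groups `N` and `U` immersed in `G` by homomorphisms, with complementary Lie algebras,
that of `N` being `Ad(G)`-stable. -/
structure IsTransversalPair (ιN : N →* G) (ιU : U →* G) (N' : EN →L[ℝ] E) (U' : EU →L[ℝ] E) :
    Prop where
  contMDiff_left : ContMDiff 𝓘(ℝ, EN) 𝓘(ℝ, E) ∞ ιN
  contMDiff_right : ContMDiff 𝓘(ℝ, EU) 𝓘(ℝ, E) ∞ ιU
  hasCoordDerivAt_left : HasCoordDerivAt 𝓘(ℝ, EN) 𝓘(ℝ, E) ιN 1 N'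
  hasCoordDerivAt_right : HasCoordDerivAt 𝓘(ℝ, EU) 𝓘(ℝ, E) ιU 1 U'
  bijective : Function.Bijective (N'.coprod U')
  adjointRep_mem : ∀ g : G, ∀ v, ∃ w, adjointRep g (N' v) = N' w

/-- Left translation, as a diffeomorphism. -/
def Diffeomorph.mulLeftLie (g : G) : G ≃ₘ^∞⟮𝓘(ℝ, E), 𝓘(ℝ, E)⟯ G where
  toEquiv := Equiv.mulLeft g
  contMDiff_toFun := contMDiff_mul_left
  contMDiff_invFun := contMDiff_mul_left

/-- Right translation, as a diffeomorphism. -/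
def Diffeomorph.mulRightLie (g : G) : G ≃ₘ^∞⟮𝓘(ℝ, E), 𝓘(ℝ, E)⟯ G where
  toEquiv := Equiv.mulRight g
  contMDiff_toFun := contMDiff_mul_right
  contMDiff_invFun := contMDiff_mul_right

namespace IsTransversalPair

variable {ιN : N →* G} {ιU : U →* G} {N' : EN →L[ℝ] E} {U' : EU →L[ℝ] E}

theorem eq_zero (h : IsTransversalPair ιN ιU N' U') {v : EN} {w : EU} (hvw : N' v + U' w = 0) :
    v = 0 ∧ w = 0 := by
  have : (N'.coprod U') (v, w) = (N'.coprod U') 0 := by simpa using hvw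
  simpa using h.bijective.1 this

theorem contMDiff_mul (h : IsTransversalPair ιN ιU N' U') :
    ContMDiff (𝓘(ℝ, EN).prod 𝓘(ℝ, EU)) 𝓘(ℝ, E) ∞ (fun p : N × U => ιN p.1 * ιU p.2) :=
  (h.contMDiff_left.comp contMDiff_fst).mul (h.contMDiff_right.comp contMDiff_snd)

theorem isLocalDiffeomorphAt_one (h : IsTransversalPair ιN ιU N' U') :
    IsLocalDiffeomorphAt (𝓘(ℝ, EN).prod 𝓘(ℝ, EU)) 𝓘(ℝ, E) ∞
      (fun p : N × U => ιN p.1 * ιU p.2) (1, 1) := by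
  refine isLocalDiffeomorphAt_of_mfderiv (Eventually.of_forall fun p => h.contMDiff_mul p) ?_
  have h1 : HasCoordDerivAt (𝓘(ℝ, EN).prod 𝓘(ℝ, EU)) 𝓘(ℝ, E)
      (fun p : N × U => ιN p.1 * ιU p.2) (1, 1) (N'.coprod U') :=
    ((h.hasCoordDerivAt_left.comp (1, 1) (hasCoordDerivAt_fst _) rfl).mul_of_eq_one
      (h.hasCoordDerivAt_right.comp (1, 1) (hasCoordDerivAt_snd _) rfl) (by simp)
      (by simp)).congr_deriv (by ext <;> simp)
  have h2 : Function.Bijective (coordDeriv (𝓘(ℝ, EN).prod 𝓘(ℝ, EU)) 𝓘(ℝ, E)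
      (fun p : N × U => ιN p.1 * ιU p.2) (1, 1)) := by
    rw [h1.coordDeriv_eq]; exact h.bijective
  exact h2

theorem isLocalDiffeomorph (h : IsTransversalPair ιN ιU N' U') :
    IsLocalDiffeomorph (𝓘(ℝ, EN).prod 𝓘(ℝ, EU)) 𝓘(ℝ, E) ∞
      (fun p : N × U => ιN p.1 * ιU p.2) := by
  rintro ⟨n, u⟩
  let T : (N × U) ≃ₘ^∞⟮𝓘(ℝ, EN).prod 𝓘(ℝ, EU), 𝓘(ℝ, EN).prod 𝓘(ℝ, EU)⟯ (N × U) :=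
    (Diffeomorph.mulLeftLie (E := EN) n⁻¹).prodCongr (Diffeomorph.mulRightLie (E := EU) u⁻¹)
  have hT : T (n, u) = (1, 1) :=
    Prod.ext (inv_mul_cancel n) (mul_inv_cancel u)
  have h1 : IsLocalDiffeomorphAt (𝓘(ℝ, EN).prod 𝓘(ℝ, EU)) (𝓘(ℝ, EN).prod 𝓘(ℝ, EU)) ∞ T (n, u) :=
    T.isLocalDiffeomorph (n, u)
  have h2 := h.isLocalDiffeomorphAt_one
  rw [← hT] at h2
  have h3 := (Diffeomorph.mulLeftLie (E := E) (ιN n)).isLocalDiffeomorph (ιN 1 * ιU 1)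
  have h4 := (Diffeomorph.mulRightLie (E := E) (ιU u)).isLocalDiffeomorph (ιN n * (ιN 1 * ιU 1))
  have h5 : IsLocalDiffeomorphAt (𝓘(ℝ, EN).prod 𝓘(ℝ, EU)) 𝓘(ℝ, E) ∞
      ((Diffeomorph.mulRightLie (E := E) (ιU u)) ∘ (Diffeomorph.mulLeftLie (E := E) (ιN n)) ∘
        (fun p : N × U => ιN p.1 * ιU p.2) ∘ T) (n, u) := by
    have h6 := h1.comp 𝓘(ℝ, E) G h2
    have h7 := h6.comp 𝓘(ℝ, E) G (g := Diffeomorph.mulLeftLie (E := E) (ιN n))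
      (by simp only [Function.comp, hT]; exact h3)
    exact h7.comp 𝓘(ℝ, E) G (g := Diffeomorph.mulRightLie (E := E) (ιU u))
      (by simp only [Function.comp, hT]; exact h4)
  refine IsLocalDiffeomorphAt.congr_of_eventuallyEq h5 (Eventually.of_forall fun p => ?_)
  change ιN p.1 * ιU p.2 = ιN n * (ιN (n⁻¹ * p.1) * ιU (p.2 * u⁻¹)) * ιU u
  simp only [map_mul, map_inv]
  group

/-- Any smooth map into `G` factors near a point as a product of smooth maps into `N` and `U`. -/
theorem exists_factorization (h : IsTransversalPair ιN ιU N' U') {f : M → G}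
    (hf : ContMDiff IM 𝓘(ℝ, E) ∞ f) (x₀ : M) :
    ∃ (p : M → N) (q : M → U), p x₀ = 1 ∧ q x₀ = 1 ∧
      ∀ᶠ x in 𝓝 x₀, ContMDiffAt IM 𝓘(ℝ, EN) ∞ p x ∧ ContMDiffAt IM 𝓘(ℝ, EU) ∞ q x ∧
        f x = f x₀ * (ιN (p x) * ιU (q x)) := by
  obtain ⟨Φ, h1, hΦ⟩ := h.isLocalDiffeomorphAt_one
  have hΦ1 : Φ (1, 1) = 1 := by rw [← hΦ h1]; simp
  have ht : (1 : G) ∈ Φ.target := hΦ1 ▸ Φ.map_source h1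
  have hs1 : Φ.symm 1 = (1, 1) := by
    conv_lhs => rw [← hΦ1]
    exact Φ.left_inv h1
  let k : M → G := fun x => (f x₀)⁻¹ * f x
  have hk : ContMDiff IM 𝓘(ℝ, E) ∞ k := contMDiff_const.mul hf
  have hk0 : k x₀ = 1 := inv_mul_cancel _
  refine ⟨fun x => (Φ.symm (k x)).1, fun x => (Φ.symm (k x)).2, by simp only [hk0, hs1],
    by simp only [hk0, hs1], ?_⟩
  have hkt : ∀ᶠ x in 𝓝 x₀, k x ∈ Φ.target :=
    hk.continuous.continuousAt.preimage_mem_nhds (by rw [hk0]; exact Φ.open_target.mem_nhds ht)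
  filter_upwards [hkt] with x hx
  have h2 : ContMDiffAt IM (𝓘(ℝ, EN).prod 𝓘(ℝ, EU)) ∞ (fun x => Φ.symm (k x)) x :=
    (Φ.symm.contMDiffOn.contMDiffAt (Φ.open_target.mem_nhds hx)).comp x (hk x)
  refine ⟨contMDiffAt_fst.comp x h2, contMDiffAt_snd.comp x h2, ?_⟩
  have h3 := hΦ (Φ.map_target hx)
  have h4 : Φ (Φ.symm (k x)) = k x := Φ.right_inv hx
  have h5 : ιN (Φ.symm (k x)).1 * ιU (Φ.symm (k x)).2 = k x := h3.trans h4
  rw [h5]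
  simp [k]

/-- The logarithmic derivatives of the factors determine that of the product. -/
theorem logDeriv_factorization (h : IsTransversalPair ιN ιU N' U') {f : M → G} {x₀ x : M}
    {p : M → N} {q : M → U} {A : EM →L[ℝ] E} {P : EM →L[ℝ] EN} {Q : EM →L[ℝ] EU}
    (hA : HasLogDerivAt IM f x A) (hP : HasLogDerivAt IM p x P) (hQ : HasLogDerivAt IM q x Q)
    (he : ∀ᶠ y in 𝓝 x, f y = f x₀ * (ιN (p y) * ιU (q y))) :
    A = adjointRep (ιU (q x))⁻¹ ∘L N' ∘L P + U' ∘L Q :=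
  hA.unique ((((hP.monoidHom_comp h.hasCoordDerivAt_left).mul
    (hQ.monoidHom_comp h.hasCoordDerivAt_right)).const_mul (f x₀)).congr he)

/-- A map tangent to `N` is locally a translate of a smooth map into `N`. -/
theorem exists_local_lift_left (h : IsTransversalPair ιN ιU N' U') {f : M → G}
    (hf : ContMDiff IM 𝓘(ℝ, E) ∞ f)
    (ht : ∀ x A, HasLogDerivAt IM f x A → ∀ v, ∃ w, A v = N' w) (x₀ : M) :
    ∃ p : M → N, ContMDiffAt IM 𝓘(ℝ, EN) ∞ p x₀ ∧ ∀ᶠ x in 𝓝 x₀, f x = f x₀ * ιN (p x) := by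
  obtain ⟨p, q, hp, hq, hpq⟩ := h.exists_factorization hf x₀
  have hq0 : ∀ᶠ x in 𝓝 x₀, HasCoordDerivAt IM 𝓘(ℝ, EU) q x 0 := by
    filter_upwards [hpq, hpq.eventually_nhds] with x ⟨h1, h2, _⟩ h3
    obtain ⟨P, hP⟩ := exists_hasLogDerivAt (h1.mdifferentiableAt (by simp))
    obtain ⟨Q, hQ⟩ := exists_hasLogDerivAt (h2.mdifferentiableAt (by simp))
    obtain ⟨A, hA⟩ := exists_hasLogDerivAt ((hf x).mdifferentiableAt (by simp))
    have hfac := h.logDeriv_factorization hA hP hQ (h3.mono fun y hy => hy.2.2)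
    refine (hQ.congr_deriv ?_).hasCoordDerivAt_zero
    ext v
    obtain ⟨w, hw⟩ := ht x A hA v
    obtain ⟨w', hw'⟩ := h.adjointRep_mem (ιU (q x))⁻¹ (P v)
    rw [hfac] at hw
    have h4 : N' w' + U' (Q v) = N' w := by rw [← hw, ← hw']; rfl
    exact (h.eq_zero (v := w' - w) (w := Q v) (by rw [map_sub, sub_add_eq_add_sub, h4, sub_self])).2
  refine ⟨p, hpq.self_of_nhds.1, ?_⟩
  filter_upwards [hpq, eventually_eq_of_mfderiv_eq_zero hq0] with x hx hqx
  rw [hx.2.2, hqx, hq, map_one, mul_one]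

/-- A map tangent to `U` is locally a translate of a smooth map into `U`. -/
theorem exists_local_lift_right (h : IsTransversalPair ιN ιU N' U') {f : M → G}
    (hf : ContMDiff IM 𝓘(ℝ, E) ∞ f)
    (ht : ∀ x A, HasLogDerivAt IM f x A → ∀ v, ∃ w, A v = U' w) (x₀ : M) :
    ∃ q : M → U, ContMDiffAt IM 𝓘(ℝ, EU) ∞ q x₀ ∧ ∀ᶠ x in 𝓝 x₀, f x = f x₀ * ιU (q x) := by
  obtain ⟨p, q, hp, hq, hpq⟩ := h.exists_factorization hf x₀
  have hp0 : ∀ᶠ x in 𝓝 x₀, HasCoordDerivAt IM 𝓘(ℝ, EN) p x 0 := by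
    filter_upwards [hpq, hpq.eventually_nhds] with x ⟨h1, h2, _⟩ h3
    obtain ⟨P, hP⟩ := exists_hasLogDerivAt (h1.mdifferentiableAt (by simp))
    obtain ⟨Q, hQ⟩ := exists_hasLogDerivAt (h2.mdifferentiableAt (by simp))
    obtain ⟨A, hA⟩ := exists_hasLogDerivAt ((hf x).mdifferentiableAt (by simp))
    have hfac := h.logDeriv_factorization hA hP hQ (h3.mono fun y hy => hy.2.2)
    refine (hP.congr_deriv ?_).hasCoordDerivAt_zero
    ext v
    obtain ⟨w, hw⟩ := ht x A hA v
    obtain ⟨w', hw'⟩ := h.adjointRep_mem (ιU (q x))⁻¹ (P v)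
    rw [hfac] at hw
    have h4 : N' w' + U' (Q v) = U' w := by rw [← hw, ← hw']; rfl
    have h5 := (h.eq_zero (v := w') (w := Q v - w)
      (by rw [map_sub, ← add_sub_assoc, h4, sub_self])).1
    rw [h5, map_zero] at hw'
    have h6 : N' (P v) = 0 := by
      rw [← adjointRep_apply_inv (ιU (q x)) (N' (P v)), hw', map_zero]
    exact (h.eq_zero (v := P v) (w := 0) (by rw [h6, map_zero, add_zero])).1
  refine ⟨q, hpq.self_of_nhds.2.1, ?_⟩
  filter_upwards [hpq, eventually_eq_of_mfderiv_eq_zero hp0] with x hx hpx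
  rw [hx.2.2, hpx, hp, map_one, one_mul]

end IsTransversalPair

/-- A map on a connected manifold that is locally a translate of a smooth map into a Lie subgroup
`L` and that meets `L` is a smooth map into `L`. -/
theorem exists_contMDiff_lift {EL : Type*} [NormedAddCommGroup EL] [NormedSpace ℝ EL]
    {L : Type*} [TopologicalSpace L] [ChartedSpace EL L] [Group L] [LieGroup 𝓘(ℝ, EL) ∞ L]
    [ConnectedSpace M] {ι : L →* G} (hι : Function.Injective ι) {f : M → G}
    (hloc : ∀ x₀, ∃ p : M → L, ContMDiffAt IM 𝓘(ℝ, EL) ∞ p x₀ ∧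
      ∀ᶠ x in 𝓝 x₀, f x = f x₀ * ι (p x))
    {x₁ : M} (hx₁ : f x₁ ∈ ι.range) :
    ∃ p : M → L, ContMDiff IM 𝓘(ℝ, EL) ∞ p ∧ ∀ x, ι (p x) = f x := by
  have hclopen : IsClopen {x | f x ∈ ι.range} := by
    constructor
    · rw [← isOpen_compl_iff, isOpen_iff_mem_nhds]
      intro x hx
      obtain ⟨p, -, hp⟩ := hloc x
      filter_upwards [hp] with y hy hyr
      refine hx ?_
      change f y ∈ ι.range at hyr
      rw [hy] at hyr
      exact (ι.range.mul_mem_cancel_right ⟨p y, rfl⟩).1 hyr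
    · rw [isOpen_iff_mem_nhds]
      intro x hx
      obtain ⟨p, -, hp⟩ := hloc x
      filter_upwards [hp] with y hy
      rw [hy]
      exact ι.range.mul_mem hx ⟨p y, rfl⟩
  have hall (x : M) : ∃ l, ι l = f x := by
    have : x ∈ {x | f x ∈ ι.range} := by rw [hclopen.eq_univ ⟨x₁, hx₁⟩]; trivial
    exact this
  choose p hp using hall
  refine ⟨p, fun x => ?_, hp⟩
  obtain ⟨p', hp', he⟩ := hloc x
  have h1 : ContMDiffAt IM 𝓘(ℝ, EL) ∞ (fun y => p x * p' y) x := contMDiffAt_const.mul hp'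
  refine h1.congr_of_eventuallyEq ?_
  filter_upwards [he] with y hy
  apply hι
  rw [hp, map_mul, hp, hy]

end Transversal

/-! ### Semidirect products -/

/-- A retract of a simply connected space is simply connected. -/
theorem SimplyConnectedSpace.of_retract {X Y : Type*} [TopologicalSpace X] [TopologicalSpace Y]
    [SimplyConnectedSpace X] {i : Y → X} {r : X → Y} (hi : Continuous i) (hr : Continuous r)
    (h : ∀ y, r (i y) = y) : SimplyConnectedSpace Y := by
  rw [simply_connected_iff_paths_homotopic']
  have hs : Function.Surjective r := fun y => ⟨i y, h y⟩
  refine ⟨hs.pathConnectedSpace hr, fun {x y} p q => ?_⟩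
  obtain ⟨F⟩ := SimplyConnectedSpace.paths_homotopic (p.map hi) (q.map hi)
  have h1 := F.map ⟨r, hr⟩
  have h2 : ((p.map hi).map hr).cast (h x).symm (h y).symm = p := by
    ext t; simp [h]
  have h3 : ((q.map hi).map hr).cast (h x).symm (h y).symm = q := by
    ext t; simp [h]
  rw [← h2, ← h3]
  exact ⟨h1.cast rfl rfl⟩

/-- A homomorphism of topological groups that is a local homeomorphism, from a connected group onto
a simply connected locally path connected one, is bijective: it is a covering map, and hence has a
continuous section, which is also a left inverse. -/
theorem MonoidHom.bijective_of_isLocalHomeomorph {X G : Type*} [TopologicalSpace X] [Group X]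
    [IsTopologicalGroup X] [ConnectedSpace X] [TopologicalSpace G] [Group G] [IsTopologicalGroup G]
    [SimplyConnectedSpace G] [LocallyPathConnectedSpace G] (f : X →* G)
    (hf : IsLocalHomeomorph f) : Function.Bijective f := by
  have hsurj : Function.Surjective f := by
    have ho : (f.range : Set G) ∈ 𝓝 1 :=
      hf.isOpenMap.isOpen_range.mem_nhds ⟨1, map_one f⟩
    exact MonoidHom.range_eq_top.1 (f.range.eq_top_of_mem_nhds_one ho)
  refine ⟨?_, hsurj⟩
  have hq : IsQuotientMap f := hf.isOpenMap.isQuotientMap hf.continuous hsurj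
  have hdisc : IsDiscrete (f.ker : Set X) := by
    refine IsDiscrete.of_nhdsWithin fun x hx => ?_
    obtain ⟨W, hW, hxW, hinj⟩ := isLocallyInjective_iff_nhds.1 hf.isLocallyInjective x
      |> fun ⟨W, hW, h⟩ => (⟨W, hW, mem_of_mem_nhds hW, h⟩ :
        ∃ W, W ∈ 𝓝 x ∧ x ∈ W ∧ InjOn f W)
    rw [le_pure_iff, mem_nhdsWithin_iff_exists_mem_nhds_inter]
    exact ⟨W, hW, fun y hy => hinj hy.1 hxW (hy.2.trans hx.symm)⟩
  have cov := (hq.isQuotientCoveringMap_of_isDiscrete_ker_monoidHom hdisc).isCoveringMap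
  obtain ⟨s, ⟨hs1, hs⟩, -⟩ := cov.existsUnique_continuousMap_lifts (ContinuousMap.id G) 1 1
    (map_one f)
  have hfs (g : G) : f (s g) = g := congr_fun hs g
  have hsf : (fun x => s (f x)) = fun x => x := by
    refine cov.eq_of_comp_eq (s.continuous.comp hf.continuous) continuous_id ?_ 1 (by simp [hs1])
    ext x
    simp [hfs]
  exact Function.LeftInverse.injective (congr_fun hsf)

section Semidirect

variable {E : Type*} [NormedAddCommGroup E] [NormedSpace ℝ E] [FiniteDimensional ℝ E]
  {G : Type*} [TopologicalSpace G] [ChartedSpace E G] [Group G] [LieGroup 𝓘(ℝ, E) ∞ G]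
  {EU : Type*} [NormedAddCommGroup EU] [NormedSpace ℝ EU] [FiniteDimensional ℝ EU]
  {U : Type*} [TopologicalSpace U] [ChartedSpace EU U] [Group U] [LieGroup 𝓘(ℝ, EU) ∞ U]
  {EN : Type*} [NormedAddCommGroup EN] [NormedSpace ℝ EN] [FiniteDimensional ℝ EN]
  {N : Type*} [TopologicalSpace N] [ChartedSpace EN N] [Group N] [LieGroup 𝓘(ℝ, EN) ∞ N]
  {ιN : N →* G} {ιU : U →* G} {N' : EN →L[ℝ] E} {U' : EU →L[ℝ] E}

/-- If `Ad(N)` acts trivially modulo the Lie algebra of `N`, then the map `(u, n) ↦ u n u⁻¹` is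
tangent to `N`, also in the direction of `u`; hence it is a smooth map into `N`. -/
theorem IsTransversalPair.exists_contMDiff_conj [ConnectedSpace U] [ConnectedSpace N]
    (h : IsTransversalPair ιN ιU N' U') (hN : Function.Injective ιN)
    (hAd : ∀ n Y, ∃ w, adjointRep (ιN n) Y - Y = N' w) :
    ∃ φ : U × N → N, ContMDiff (𝓘(ℝ, EU).prod 𝓘(ℝ, EN)) 𝓘(ℝ, EN) ∞ φ ∧
      ∀ x, ιN (φ x) = ιU x.1 * ιN x.2 * (ιU x.1)⁻¹ := by
  have hU1 : ContMDiff (𝓘(ℝ, EU).prod 𝓘(ℝ, EN)) 𝓘(ℝ, E) ∞ (fun x : U × N => ιU x.1) :=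
    h.contMDiff_right.comp contMDiff_fst
  have hN1 : ContMDiff (𝓘(ℝ, EU).prod 𝓘(ℝ, EN)) 𝓘(ℝ, E) ∞ (fun x : U × N => ιN x.2) :=
    h.contMDiff_left.comp contMDiff_snd
  refine exists_contMDiff_lift (x₁ := (1, 1)) hN
    (h.exists_local_lift_left ((hU1.mul hN1).mul hU1.inv) ?_) (by simp)
  intro x A hA v
  obtain ⟨B, hB⟩ := exists_hasLogDerivAt (IM := 𝓘(ℝ, EU).prod 𝓘(ℝ, EN))
    (f := fun x : U × N => x.1) (x := x) mdifferentiableAt_fst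
  obtain ⟨C, hC⟩ := exists_hasLogDerivAt (IM := 𝓘(ℝ, EU).prod 𝓘(ℝ, EN))
    (f := fun x : U × N => x.2) (x := x) mdifferentiableAt_snd
  have hB' := hB.monoidHom_comp h.hasCoordDerivAt_right
  have hC' := hC.monoidHom_comp h.hasCoordDerivAt_left
  have h1 := (hB'.mul hC').mul (hB'.inv ((hU1 x).mdifferentiableAt (by simp)))
  have h2 := DFunLike.congr_fun (hA.unique h1) v
  obtain ⟨w, hw⟩ := hAd (x.2)⁻¹ (U' (B v))
  obtain ⟨w', hw'⟩ := h.adjointRep_mem (ιU x.1) (w + C v)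
  refine ⟨w', ?_⟩
  rw [h2, ← hw', map_add, ← hw, map_inv, inv_inv]
  simp only [add_apply, neg_apply, ContinuousLinearMap.comp_apply, map_add, map_sub]
  abel

/-- The Lie group `G` is the semidirect product of its subgroups `N` and `U`. -/
theorem IsTransversalPair.isLieSemidirectProduct [ConnectedSpace U] [ConnectedSpace N]
    [SimplyConnectedSpace G] (h : IsTransversalPair ιN ιU N' U') (hN : Function.Injective ιN)
    (hAd : ∀ n Y, ∃ w, adjointRep (ιN n) Y - Y = N' w) :
    IsLieSemidirectProduct (E := E) (EU := EU) (EN := EN) ιU ιN := by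
  have : IsTopologicalGroup G := topologicalGroup_of_lieGroup 𝓘(ℝ, E) ∞
  have : IsTopologicalGroup U := topologicalGroup_of_lieGroup 𝓘(ℝ, EU) ∞
  have : IsTopologicalGroup N := topologicalGroup_of_lieGroup 𝓘(ℝ, EN) ∞
  have : LocallyPathConnectedSpace G := ChartedSpace.locallyPathConnectedSpace E G
  obtain ⟨c, hc, hcι⟩ := h.exists_contMDiff_conj hN hAd
  let φ : U →* MulAut N :=
    { toFun := fun u =>
        { toFun := fun n => c (u, n)
          invFun := fun n => c (u⁻¹, n)
          left_inv := fun n => hN (by simp [hcι, mul_assoc])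
          right_inv := fun n => hN (by simp [hcι, mul_assoc])
          map_mul' := fun a b => hN (by simp [hcι]) }
      map_one' := by ext n; exact hN (by simp [hcι])
      map_mul' := fun u v => by ext n; exact hN (by simp [hcι, mul_assoc]) }
  have hφ (u : U) (n : N) : φ u n = c (u, n) := rfl
  let f : N ⋊[φ] U →* G := SemidirectProduct.lift ιN ιU fun u => by
    ext n
    simp [hφ, hcι]
  have hf (x : N ⋊[φ] U) : f x = ιN x.left * ιU x.right := rfl
  -- The semidirect product carries the topology of `N × U`.
  let τ : TopologicalSpace (N ⋊[φ] U) :=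
    TopologicalSpace.induced SemidirectProduct.equivProd inferInstance
  let e : (N ⋊[φ] U) ≃ₜ N × U := SemidirectProduct.equivProd.toHomeomorphOfIsInducing ⟨rfl⟩
  have hl : Continuous (fun x : N ⋊[φ] U => x.left) := continuous_fst.comp e.continuous
  have hr : Continuous (fun x : N ⋊[φ] U => x.right) := continuous_snd.comp e.continuous
  have : IsTopologicalGroup (N ⋊[φ] U) :=
    { continuous_mul := by
        rw [e.isInducing.continuous_iff]
        refine Continuous.prodMk ?_ ?_
        · exact (hl.comp continuous_fst).mul (hc.continuous.comp
            ((hr.comp continuous_fst).prodMk (hl.comp continuous_snd)))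
        · exact (hr.comp continuous_fst).mul (hr.comp continuous_snd)
      continuous_inv := by
        rw [e.isInducing.continuous_iff]
        exact Continuous.prodMk (hc.continuous.comp (hr.inv.prodMk hl.inv)) hr.inv }
  have : ConnectedSpace (N ⋊[φ] U) := e.symm.surjective.connectedSpace e.symm.continuous
  have hloc : IsLocalHomeomorph f :=
    h.isLocalDiffeomorph.isLocalHomeomorph.comp e.isLocalHomeomorph
  have hbij := f.bijective_of_isLocalHomeomorph hloc
  have hbij' : Function.Bijective (fun p : N × U => ιN p.1 * ιU p.2) := by
    have : (fun p : N × U => ιN p.1 * ιU p.2) = f ∘ e.symm := rfl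
    rw [this]
    exact hbij.comp e.symm.bijective
  exact ⟨φ, hc, fun u n => hcι (u, n), MulEquiv.ofBijective f hbij,
    h.isLocalDiffeomorph.diffeomorphOfBijective hbij', fun x => rfl, fun x => rfl⟩

end Semidirect

/-! ### Homogeneous spaces -/

section HomogeneousSpace

variable {E : Type*} [NormedAddCommGroup E] [NormedSpace ℝ E]
  {G : Type*} [TopologicalSpace G] [ChartedSpace E G] [Group G]
  {W : Type*} [NormedAddCommGroup W] [NormedSpace ℝ W]

/-- A slice for the right translations by the subgroup `K`: the map `(w, k) ↦ σ(w) k` is a bijection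
from the product of an open subset `B` of `W` and `K` onto an open subset `O` of `G`, and
both `σ` and the map `r` that recovers the parameter `w` are smooth. -/
structure CosetSlice (E : Type*) [NormedAddCommGroup E] [NormedSpace ℝ E]
    {G : Type*} [TopologicalSpace G] [ChartedSpace E G] [Group G] (K : Subgroup G)
    (W : Type*) [NormedAddCommGroup W] [NormedSpace ℝ W] where
  σ : W → G
  r : G → W
  B : Set W
  O : Set G
  isOpen_B : IsOpen B
  isOpen_O : IsOpen O
  contMDiffOn_σ : ContMDiffOn 𝓘(ℝ, W) 𝓘(ℝ, E) ∞ σ B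
  contMDiffOn_r : ContMDiffOn 𝓘(ℝ, E) 𝓘(ℝ, W) ∞ r O
  one_mem : 1 ∈ O
  σ_mem : ∀ w ∈ B, σ w ∈ O
  r_σ : ∀ w ∈ B, r (σ w) = w
  r_mem : ∀ g ∈ O, r g ∈ B
  inv_mul_mem : ∀ g ∈ O, (σ (r g))⁻¹ * g ∈ K
  mul_mem : ∀ g ∈ O, ∀ k ∈ K, g * k ∈ O
  r_mul : ∀ g ∈ O, ∀ k ∈ K, r (g * k) = r g

/-- A linear map onto a complement of the range of an injective linear map. -/
theorem exists_bijective_coprod [FiniteDimensional ℝ E] [FiniteDimensional ℝ W] {EL : Type*}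
    [NormedAddCommGroup EL] [NormedSpace ℝ EL] [FiniteDimensional ℝ EL] {j' : EL →L[ℝ] E}
    (hj : Function.Injective j')
    (hW : Module.finrank ℝ W + Module.finrank ℝ EL = Module.finrank ℝ E) :
    ∃ T : W →L[ℝ] E, Function.Bijective (T.coprod j') := by
  obtain ⟨Q, hQ⟩ := (j' : EL →ₗ[ℝ] E).range.exists_isCompl
  have h1 : Module.finrank ℝ (j' : EL →ₗ[ℝ] E).range = Module.finrank ℝ EL :=
    LinearMap.finrank_range_of_inj hj
  have h2 := Submodule.finrank_add_eq_of_isCompl hQ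
  have h3 : Module.finrank ℝ W = Module.finrank ℝ Q := by omega
  let e : W ≃ₗ[ℝ] Q := LinearEquiv.ofFinrankEq W Q h3
  let T : W →ₗ[ℝ] E := Q.subtype ∘ₗ (e : W →ₗ[ℝ] Q)
  refine ⟨T.toContinuousLinearMap, ?_⟩
  have hinj : Function.Injective (T.toContinuousLinearMap.coprod j') := by
    rw [injective_iff_map_eq_zero]
    rintro ⟨w, v⟩ h
    have h4 : (e w : E) + j' v = 0 := h
    have h5 : (e w : E) ∈ (j' : EL →ₗ[ℝ] E).range := ⟨-v, by
      rw [map_neg, neg_eq_iff_add_eq_zero, add_comm]; exact h4⟩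
    have h6 : (e w : E) = 0 := Submodule.disjoint_def.1 hQ.disjoint _ h5 (e w).2
    have h7 : w = 0 := by simpa using h6
    have h8 : v = 0 := by
      rw [h6, zero_add] at h4
      exact hj (h4.trans (map_zero j').symm)
    rw [h7, h8]; rfl
  refine ⟨hinj, ?_⟩
  have := (LinearMap.injective_iff_surjective_of_finrank_eq_finrank (f :=
    (T.toContinuousLinearMap.coprod j' : W × EL →ₗ[ℝ] E))
    (by rw [Module.finrank_prod, hW])).1 hinj
  exact this

/-- An embedded Lie subgroup has a slice. -/
theorem exists_cosetSlice [LieGroup 𝓘(ℝ, E) ∞ G] [FiniteDimensional ℝ E] [FiniteDimensional ℝ W]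
    {EL : Type*} [NormedAddCommGroup EL] [NormedSpace ℝ EL] [FiniteDimensional ℝ EL]
    {L : Type*} [TopologicalSpace L] [ChartedSpace EL L] [Group L] [LieGroup 𝓘(ℝ, EL) ∞ L]
    {j : L →* G} (hjs : ContMDiff 𝓘(ℝ, EL) 𝓘(ℝ, E) ∞ j) (hji : IsInducing j) {j' : EL →L[ℝ] E}
    (hj : HasCoordDerivAt 𝓘(ℝ, EL) 𝓘(ℝ, E) j 1 j') (hj' : Function.Injective j')
    (hW : Module.finrank ℝ W + Module.finrank ℝ EL = Module.finrank ℝ E) :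
    Nonempty (CosetSlice E j.range W) := by
  classical
  have : IsTopologicalGroup G := topologicalGroup_of_lieGroup 𝓘(ℝ, E) ∞
  obtain ⟨T, hT⟩ := exists_bijective_coprod (W := W) hj' hW
  let σ : W → G := fun w => oneChartInv E G (chartOne E G + T w)
  have hT0 : chartOne E G + T 0 = chartOne E G := by simp
  have hσ0 : σ 0 = 1 := by simp only [σ, hT0, oneChartInv_chartOne]
  have hlc : ContDiff ℝ ∞ (fun w : W => chartOne E G + T w) := contDiff_const.add T.contDiff
  have hσs : ∀ᶠ w in 𝓝 (0 : W), ContMDiffAt 𝓘(ℝ, W) 𝓘(ℝ, E) ∞ σ w := by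
    have hc : Tendsto (fun w : W => chartOne E G + T w) (𝓝 0) (𝓝 (chartOne E G)) := by
      simpa using hlc.continuous.tendsto 0
    filter_upwards [hc.eventually (eventually_oneChartInv E G)] with w hw
    exact hw.1.comp w hlc.contDiffAt.contMDiffAt
  have hσd : HasCoordDerivAt 𝓘(ℝ, W) 𝓘(ℝ, E) σ 0 T := by
    have h1 : HasCoordDerivAt 𝓘(ℝ, W) 𝓘(ℝ, E) (fun w : W => chartOne E G + T w) 0 T :=
      hasCoordDerivAt_iff_hasFDerivAt.2 (T.hasFDerivAt.const_add _)
    exact (hasCoordDerivAt_oneChartInv E G).comp 0 h1 hT0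
  let Θ : W × L → G := fun p => σ p.1 * j p.2
  have hΘs : ∀ᶠ p in 𝓝 ((0, 1) : W × L),
      ContMDiffAt (𝓘(ℝ, W).prod 𝓘(ℝ, EL)) 𝓘(ℝ, E) ∞ Θ p := by
    filter_upwards [(continuous_fst.tendsto ((0, 1) : W × L)).eventually hσs] with p hp
    exact (hp.comp p contMDiffAt_fst).mul ((hjs p.2).comp p contMDiffAt_snd)
  have hΘd : HasCoordDerivAt (𝓘(ℝ, W).prod 𝓘(ℝ, EL)) 𝓘(ℝ, E) Θ (0, 1) (T.coprod j') :=
    ((hσd.comp (0, 1) (hasCoordDerivAt_fst _) rfl).mul_of_eq_one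
      (hj.comp (0, 1) (hasCoordDerivAt_snd _) rfl) hσ0 (map_one j)).congr_deriv
        (by ext <;> simp)
  have hloc : IsLocalDiffeomorphAt (𝓘(ℝ, W).prod 𝓘(ℝ, EL)) 𝓘(ℝ, E) ∞ Θ (0, 1) := by
    refine isLocalDiffeomorphAt_of_mfderiv hΘs ?_
    have : Function.Bijective (coordDeriv (𝓘(ℝ, W).prod 𝓘(ℝ, EL)) 𝓘(ℝ, E) Θ (0, 1)) := by
      rw [hΘd.coordDeriv_eq]; exact hT
    exact this
  obtain ⟨P, hP, hPΘ⟩ := hloc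
  obtain ⟨B₀, hB₀, V₀, hV₀, hBV⟩ := mem_nhds_prod_iff.1 (P.open_source.mem_nhds hP)
  obtain ⟨V', hV', hVV⟩ : ∃ V' ∈ 𝓝 (1 : G), j ⁻¹' V' ⊆ V₀ := by
    have h1 := hji.nhds_eq_comap (1 : L)
    rw [map_one] at h1
    rw [h1, mem_comap] at hV₀
    exact hV₀
  have hdiv : ∀ᶠ p in 𝓝 ((0, 0) : W × W), (σ p.1)⁻¹ * σ p.2 ∈ V' := by
    have hc : ContinuousAt σ 0 := hσs.self_of_nhds.continuousAt
    have h1 : ContinuousAt (fun p : W × W => (σ p.1)⁻¹ * σ p.2) (0, 0) :=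
      (ContinuousAt.comp (x := ((0, 0) : W × W)) (f := Prod.fst) hc continuousAt_fst).inv.mul
        (ContinuousAt.comp (x := ((0, 0) : W × W)) (f := Prod.snd) hc continuousAt_snd)
    exact h1.preimage_mem_nhds (by simpa [hσ0] using hV')
  rw [nhds_prod_eq] at hdiv
  obtain ⟨B₁, hB₁, hdiv⟩ := eventually_prod_self_iff.1 hdiv |> fun h =>
    (h : ∃ t ∈ 𝓝 (0 : W), ∀ x ∈ t, ∀ y ∈ t, (σ x)⁻¹ * σ y ∈ V')
  obtain ⟨B, hBsub, hBo, h0B⟩ := mem_nhds_iff.1 (inter_mem (inter_mem hB₀ hB₁) hσs)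
  -- The parameter `w` is determined by the coset of `σ w`.
  have huniq : ∀ w ∈ B, ∀ w' ∈ B, ∀ l l', σ w * j l = σ w' * j l' → w = w' := by
    intro w hw w' hw' l l' he
    have h1 : j (l' * l⁻¹) = (σ w')⁻¹ * σ w := by
      rw [map_mul, map_inv, mul_inv_eq_iff_eq_mul, mul_assoc, he]; group
    have h2 : l' * l⁻¹ ∈ V₀ := hVV (by
      change j (l' * l⁻¹) ∈ V'
      rw [h1]; exact hdiv _ (hBsub hw').1.2 _ (hBsub hw).1.2)
    have h3 : Θ (w, 1) = Θ (w', l' * l⁻¹) := by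
      simp only [Θ, h1]; simp
    have h4 : ((w, 1) : W × L) ∈ P.source := hBV ⟨(hBsub hw).1.1, mem_of_mem_nhds hV₀⟩
    have h5 : ((w', l' * l⁻¹) : W × L) ∈ P.source := hBV ⟨(hBsub hw').1.1, h2⟩
    have h6 := P.injOn h4 h5 ((hPΘ h4).symm.trans (h3.trans (hPΘ h5)))
    exact congrArg Prod.fst h6
  let O : Set G := {g | ∃ w ∈ B, ∃ l, g = σ w * j l}
  let r : G → W := fun g => if hg : g ∈ O then hg.choose else 0
  have hr : ∀ w ∈ B, ∀ l, r (σ w * j l) = w := by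
    intro w hw l
    have hg : σ w * j l ∈ O := ⟨w, hw, l, rfl⟩
    have h1 : r (σ w * j l) = hg.choose := dif_pos hg
    rw [h1]
    obtain ⟨h2, l', h3⟩ := hg.choose_spec
    exact (huniq _ h2 _ hw _ _ h3.symm)
  have hlocO : ∀ g ∈ O, ∃ ψ : G → W, ContMDiffAt 𝓘(ℝ, E) 𝓘(ℝ, W) ∞ ψ g ∧
      ∀ᶠ h in 𝓝 g, h ∈ O ∧ r h = ψ h := by
    rintro g ⟨w, hw, l, rfl⟩
    let τ : G → G := fun h => h * (j l)⁻¹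
    have hτ : ContMDiff 𝓘(ℝ, E) 𝓘(ℝ, E) ∞ τ := contMDiff_mul_right
    have hws : ((w, 1) : W × L) ∈ P.source := hBV ⟨(hBsub hw).1.1, mem_of_mem_nhds hV₀⟩
    have hτg : τ (σ w * j l) = P (w, 1) := by
      rw [← hPΘ hws]; simp [τ, Θ]
    have hτt : τ (σ w * j l) ∈ P.target := hτg ▸ P.map_source hws
    have hPs : P.symm (τ (σ w * j l)) = (w, 1) := by rw [hτg]; exact P.left_inv hws
    have h1 : ContMDiffAt 𝓘(ℝ, E) (𝓘(ℝ, W).prod 𝓘(ℝ, EL)) ∞ (fun h => P.symm (τ h))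
        (σ w * j l) :=
      (P.symm.contMDiffOn.contMDiffAt (P.open_target.mem_nhds hτt)).comp _ (hτ _)
    refine ⟨fun h => (P.symm (τ h)).1, contMDiffAt_fst.comp _ h1, ?_⟩
    have h2 : ∀ᶠ h in 𝓝 (σ w * j l), (P.symm (τ h)).1 ∈ B :=
      (continuousAt_fst.comp h1.continuousAt).preimage_mem_nhds
        (hBo.mem_nhds (by simp only [Function.comp, hPs]; exact hw))
    have h3 : ∀ᶠ h in 𝓝 (σ w * j l), τ h ∈ P.target :=
      hτ.continuous.continuousAt.preimage_mem_nhds (P.open_target.mem_nhds hτt)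
    filter_upwards [h2, h3] with h hh2 hh3
    have h4 : Θ (P.symm (τ h)) = τ h := (hPΘ (P.map_target hh3)).trans (P.right_inv hh3)
    have h5 : h = σ (P.symm (τ h)).1 * j ((P.symm (τ h)).2 * l) := by
      rw [map_mul, ← mul_assoc, show σ (P.symm (τ h)).1 * j (P.symm (τ h)).2 = τ h from h4]
      simp [τ]
    refine ⟨⟨_, hh2, _, h5⟩, ?_⟩
    conv_lhs => rw [h5]
    exact hr _ hh2 _
  exact ⟨{
    σ := σ
    r := r
    B := B
    O := O
    isOpen_B := hBo
    isOpen_O := by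
      rw [isOpen_iff_mem_nhds]
      intro g hg
      obtain ⟨ψ, -, h⟩ := hlocO g hg
      exact h.mono fun h hh => hh.1
    contMDiffOn_σ := fun w hw => ((hBsub hw).2 : ContMDiffAt _ _ _ _ _).contMDiffWithinAt
    contMDiffOn_r := fun g hg => by
      obtain ⟨ψ, hψ, h⟩ := hlocO g hg
      exact (hψ.congr_of_eventuallyEq (h.mono fun h hh => hh.2)).contMDiffWithinAt
    one_mem := ⟨0, h0B, 1, by simp [hσ0]⟩
    σ_mem := fun w hw => ⟨w, hw, 1, by simp⟩
    r_σ := fun w hw => by simpa using hr w hw 1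
    r_mem := by
      rintro g ⟨w, hw, l, rfl⟩
      rw [hr w hw]; exact hw
    inv_mul_mem := by
      rintro g ⟨w, hw, l, rfl⟩
      rw [hr w hw]; exact ⟨l, by simp⟩
    mul_mem := by
      rintro g ⟨w, hw, l, rfl⟩ _ ⟨k, rfl⟩
      exact ⟨w, hw, l * k, by simp [mul_assoc]⟩
    r_mul := by
      rintro g ⟨w, hw, l, rfl⟩ _ ⟨k, rfl⟩
      rw [mul_assoc, ← map_mul, hr w hw, hr w hw] }⟩

namespace CosetSlice

variable {K : Subgroup G} (S : CosetSlice E K W)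

include S

omit S in
theorem exists_out_eq (K : Subgroup G) (g : G) : ∃ k ∈ K, ((g : G ⧸ K)).out = g * k := by
  obtain ⟨k, hk⟩ := QuotientGroup.mk_out_eq_mul K g
  exact ⟨k, k.2, hk⟩

theorem mem_iff (a g : G) : a * ((g : G ⧸ K)).out ∈ S.O ↔ a * g ∈ S.O := by
  obtain ⟨k, hk, he⟩ := exists_out_eq K g
  rw [he, ← mul_assoc]
  refine ⟨fun h => ?_, fun h => S.mul_mem _ h _ hk⟩
  simpa using S.mul_mem _ h _ (K.inv_mem hk)

theorem r_out {a g : G} (h : a * g ∈ S.O) : S.r (a * ((g : G ⧸ K)).out) = S.r (a * g) := by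
  obtain ⟨k, hk, he⟩ := exists_out_eq K g
  rw [he, ← mul_assoc, S.r_mul _ h _ hk]

variable [LieGroup 𝓘(ℝ, E) ∞ G] [IsTopologicalGroup G]

/-- The chart of `G ⧸ K` around the coset of `g` that has the inverse `w ↦ g σ(w) K`. -/
noncomputable def chart (g : G) : OpenPartialHomeomorph (G ⧸ K) W where
  toFun q := S.r (g⁻¹ * q.out)
  invFun w := ((g * S.σ w : G) : G ⧸ K)
  source := {q | g⁻¹ * q.out ∈ S.O}
  target := S.B
  map_source' q hq := S.r_mem _ hq
  map_target' w hw := by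
    change g⁻¹ * (((g * S.σ w : G) : G ⧸ K)).out ∈ S.O
    rw [S.mem_iff]; simpa using S.σ_mem w hw
  left_inv' q hq := by
    have h1 := S.inv_mul_mem _ hq
    have h2 : ((g * S.σ (S.r (g⁻¹ * q.out)) : G) : G ⧸ K) = (q.out : G ⧸ K) := by
      rw [QuotientGroup.eq]
      simpa [mul_assoc] using h1
    exact h2.trans q.out_eq'
  right_inv' w hw := by
    have h1 : g⁻¹ * (g * S.σ w) ∈ S.O := by simpa using S.σ_mem w hw
    change S.r (g⁻¹ * (((g * S.σ w : G) : G ⧸ K)).out) = w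
    rw [S.r_out h1]; simpa using S.r_σ w hw
  open_source := by
    rw [← QuotientGroup.isOpenQuotientMap_mk.isQuotientMap.isOpen_preimage]
    have : ((↑) : G → G ⧸ K) ⁻¹' {q | g⁻¹ * q.out ∈ S.O} = (fun h => g⁻¹ * h) ⁻¹' S.O := by
      ext h; exact S.mem_iff _ _
    rw [this]
    exact S.isOpen_O.preimage (continuous_const_mul _)
  open_target := S.isOpen_B
  continuousOn_toFun := by
    intro q hq
    refine ContinuousAt.continuousWithinAt ?_
    obtain ⟨h, rfl⟩ := QuotientGroup.mk_surjective q
    have hh : g⁻¹ * h ∈ S.O := (S.mem_iff _ _).1 hq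
    refine QuotientGroup.isOpenQuotientMap_mk.continuousAt_comp_iff.1 ?_
    have h1 : ContinuousAt (fun h => S.r (g⁻¹ * h)) h :=
      ContinuousAt.comp (f := fun h => g⁻¹ * h)
        (S.contMDiffOn_r.continuousOn.continuousAt (S.isOpen_O.mem_nhds hh))
        (continuous_const_mul _).continuousAt
    refine h1.congr ?_
    filter_upwards [(continuous_const_mul g⁻¹).continuousAt.preimage_mem_nhds
      (S.isOpen_O.mem_nhds hh)] with h' hh'
    exact (S.r_out hh').symm
  continuousOn_invFun := QuotientGroup.continuous_mk.comp_continuousOn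
    (continuousOn_const.mul S.contMDiffOn_σ.continuousOn)

/-- The charts of a slice, as a charted space structure. -/
noncomputable abbrev chartedSpace : ChartedSpace W (G ⧸ K) where
  atlas := range S.chart
  chartAt q := S.chart q.out
  mem_chart_source q := by
    change (q.out)⁻¹ * q.out ∈ S.O
    rw [inv_mul_cancel]; exact S.one_mem
  chart_mem_atlas q := ⟨_, rfl⟩

theorem contMDiffAt_r_mul {a h : G} (hh : a * h ∈ S.O) :
    ContMDiffAt 𝓘(ℝ, E) 𝓘(ℝ, W) ∞ (fun h => S.r (a * h)) h :=
  (S.contMDiffOn_r.contMDiffAt (S.isOpen_O.mem_nhds hh)).comp h contMDiff_mul_left.contMDiffAt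

theorem contMDiffAt_mul_σ {a : G} {w : W} (hw : w ∈ S.B) :
    ContMDiffAt 𝓘(ℝ, W) 𝓘(ℝ, E) ∞ (fun w => a * S.σ w) w :=
  contMDiffAt_const.mul (S.contMDiffOn_σ.contMDiffAt (S.isOpen_B.mem_nhds hw))

theorem isManifold : @IsManifold ℝ _ W _ _ W _ 𝓘(ℝ, W) ∞ (G ⧸ K) _ S.chartedSpace := by
  let _ := S.chartedSpace
  refine isManifold_of_contDiffOn 𝓘(ℝ, W) ∞ (G ⧸ K) ?_
  rintro _ _ ⟨g, rfl⟩ ⟨g', rfl⟩ w hw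
  have hwB : w ∈ S.B := hw.1.1
  have hwO : g'⁻¹ * (g * S.σ w) ∈ S.O := (S.mem_iff _ _).1 hw.1.2
  refine ContDiffAt.contDiffWithinAt ?_
  have h1 : ContMDiffAt 𝓘(ℝ, W) 𝓘(ℝ, W) ∞ (fun w => S.r (g'⁻¹ * (g * S.σ w))) w :=
    ContMDiffAt.comp (f := fun w => g * S.σ w) w (S.contMDiffAt_r_mul hwO)
      (S.contMDiffAt_mul_σ hwB)
  refine (contMDiffAt_iff_contDiffAt.1 h1).congr_of_eventuallyEq ?_
  have h2 : ContinuousAt (fun w => g'⁻¹ * (g * S.σ w)) w :=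
    continuousAt_const.mul (S.contMDiffAt_mul_σ hwB).continuousAt
  filter_upwards [h2.preimage_mem_nhds (S.isOpen_O.mem_nhds hwO)] with w' hw'
  exact S.r_out hw'

theorem isHomogeneousManifold : IsHomogeneousManifold (E := E) K S.chartedSpace := by
  let _ := S.chartedSpace
  have hM := S.isManifold
  have hO (h : G) : ((h : G ⧸ K)).out⁻¹ * h ∈ S.O := by
    rw [← S.mem_iff, inv_mul_cancel]; exact S.one_mem
  have hmk : ContMDiff 𝓘(ℝ, E) 𝓘(ℝ, W) ∞ (fun g : G => (g : G ⧸ K)) := by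
    intro h
    have hev : ∀ᶠ h' in 𝓝 h, ((h : G ⧸ K)).out⁻¹ * h' ∈ S.O :=
      (continuous_const_mul _).continuousAt.preimage_mem_nhds (S.isOpen_O.mem_nhds (hO h))
    rw [contMDiffAt_iff_target]
    refine ⟨QuotientGroup.continuous_mk.continuousAt,
      (S.contMDiffAt_r_mul (hO h)).congr_of_eventuallyEq ?_⟩
    filter_upwards [hev] with h' hh'
    exact S.r_out hh'
  refine ⟨hM, hmk, fun h => ?_⟩
  -- The chart at the coset of `h`, composed with the projection, has the section `w ↦ a σ(w) k`.
  set a := ((h : G ⧸ K)).out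
  set w₀ := S.r (a⁻¹ * h)
  have hw₀ : w₀ ∈ S.B := S.r_mem _ (hO h)
  set k := (S.σ w₀)⁻¹ * (a⁻¹ * h)
  have hk : k ∈ K := S.inv_mul_mem _ (hO h)
  have hs0 : a * S.σ w₀ * k = h := by simp [k, mul_assoc]
  have hs : ContMDiffAt 𝓘(ℝ, W) 𝓘(ℝ, E) ∞ (fun w => a * S.σ w * k) w₀ :=
    (S.contMDiffAt_mul_σ hw₀).mul contMDiffAt_const
  have h1 := (hs.mdifferentiableAt (by simp)).hasCoordDerivAt
  have h2 := ((hmk h).mdifferentiableAt (by simp)).hasCoordDerivAt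
  have h3 := (hasCoordDerivAt_extChartAt (I := 𝓘(ℝ, W)) (h : G ⧸ K)).comp w₀
    (h2.comp w₀ h1 hs0) (by rw [hs0])
  have h4 : ∀ w ∈ S.B, extChartAt 𝓘(ℝ, W) (h : G ⧸ K) ((a * S.σ w * k : G) : G ⧸ K) = w := by
    intro w hw
    have h5 : a⁻¹ * (a * S.σ w * k) = S.σ w * k := by group
    have h6 : S.σ w * k ∈ S.O := S.mul_mem _ (S.σ_mem w hw) k hk
    change S.r (a⁻¹ * (((a * S.σ w * k : G) : G ⧸ K)).out) = w
    rw [S.r_out (by rw [h5]; exact h6), h5, S.r_mul _ (S.σ_mem w hw) k hk, S.r_σ w hw]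
  have h7 := (hasCoordDerivAt_id (I := 𝓘(ℝ, W)) (x := w₀)).unique (h3.congr
    (by filter_upwards [S.isOpen_B.mem_nhds hw₀] with w hw using (h4 w hw).symm))
  intro v
  exact ⟨_, (DFunLike.congr_fun h7 v).symm⟩

end CosetSlice

end HomogeneousSpace

/-! ### Coset spaces of semidirect products -/

section SemidirectCosets

variable {E : Type*} [NormedAddCommGroup E] [NormedSpace ℝ E] [FiniteDimensional ℝ E]
  {G : Type*} [TopologicalSpace G] [ChartedSpace E G] [Group G] [LieGroup 𝓘(ℝ, E) ∞ G]
  {EU : Type*} [NormedAddCommGroup EU] [NormedSpace ℝ EU] [FiniteDimensional ℝ EU]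
  {U : Type*} [TopologicalSpace U] [ChartedSpace EU U] [Group U] [LieGroup 𝓘(ℝ, EU) ∞ U]
  {EN : Type*} [NormedAddCommGroup EN] [NormedSpace ℝ EN] [FiniteDimensional ℝ EN]
  {N : Type*} [TopologicalSpace N] [ChartedSpace EN N] [Group N] [LieGroup 𝓘(ℝ, EN) ∞ N]
  {ιN : N →* G} {ιU : U →* G} {K : Subgroup G}

/-- If `(n, u) ↦ n u` is a bijection `N × U → G` and `K ⊆ U`, then `n u K ↦ (u K, n)` is a bijection
`G / K → U / K × N`. -/
noncomputable def cosetEquivProd (ψ : N × U ≃ G) (hψ : ∀ n u, ψ (n, u) = ιN n * ιU u)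
    (hK : K ≤ ιU.range) : G ⧸ K ≃ (U ⧸ K.comap ιU) × N where
  toFun := Quotient.lift (fun g : G => (((ψ.symm g).2 : U ⧸ K.comap ιU), (ψ.symm g).1)) <| by
    intro g g' hg
    have hg' : g⁻¹ * g' ∈ K := QuotientGroup.leftRel_apply.1 hg
    obtain ⟨u, hu⟩ := hK hg'
    have h1 : ψ.symm g' = ((ψ.symm g).1, (ψ.symm g).2 * u) := by
      rw [Equiv.symm_apply_eq, hψ, map_mul, ← mul_assoc, ← hψ, hu]
      simp
    simp only [h1, Prod.mk.injEq, and_true]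
    rw [QuotientGroup.eq]
    simpa [hu] using hg'
  invFun x := Quotient.lift (fun u : U => ((ιN x.2 * ιU u : G) : G ⧸ K)) (by
    intro u u' hu
    have hu' : u⁻¹ * u' ∈ K.comap ιU := QuotientGroup.leftRel_apply.1 hu
    rw [QuotientGroup.eq]
    simpa [mul_assoc] using hu') x.1
  left_inv := by
    intro q
    obtain ⟨g, rfl⟩ := QuotientGroup.mk_surjective q
    change ((ιN (ψ.symm g).1 * ιU (ψ.symm g).2 : G) : G ⧸ K) = g
    rw [← hψ]; simp
  right_inv := by
    rintro ⟨q, n⟩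
    obtain ⟨u, rfl⟩ := QuotientGroup.mk_surjective q
    change (((ψ.symm (ιN n * ιU u)).2 : U ⧸ K.comap ιU), (ψ.symm (ιN n * ιU u)).1) = (↑u, n)
    rw [← hψ]; simp

/-- The bijection `cosetEquivProd` is a diffeomorphism, as both coset spaces are the bases of
submersions. -/
theorem nonempty_diffeomorph_coset_prod {F₀ F₁ : Type*}
    [NormedAddCommGroup F₀] [NormedSpace ℝ F₀] [FiniteDimensional ℝ F₀]
    [NormedAddCommGroup F₁] [NormedSpace ℝ F₁] [FiniteDimensional ℝ F₁]
    [c₀ : ChartedSpace F₀ (G ⧸ K)] [c₁ : ChartedSpace F₁ (U ⧸ K.comap ιU)]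
    (h₀ : IsHomogeneousManifold (E := E) K c₀)
    (h₁ : IsHomogeneousManifold (E := EU) (K.comap ιU) c₁)
    (Ψ : (N × U) ≃ₘ^∞⟮𝓘(ℝ, EN).prod 𝓘(ℝ, EU), 𝓘(ℝ, E)⟯ G)
    (hΨ : ∀ n u, Ψ (n, u) = ιN n * ιU u) (hK : K ≤ ιU.range) :
    Nonempty ((G ⧸ K) ≃ₘ^∞⟮𝓘(ℝ, F₀), 𝓘(ℝ, F₁).prod 𝓘(ℝ, EN)⟯ ((U ⧸ K.comap ιU) × N)) := by
  obtain ⟨m₀, s₀, d₀⟩ := h₀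
  obtain ⟨m₁, s₁, d₁⟩ := h₁
  refine ⟨⟨cosetEquivProd Ψ.toEquiv hΨ hK, ?_, ?_⟩⟩
  · refine contMDiff_of_comp_submersion s₀ d₀ QuotientGroup.mk_surjective ?_
    exact (s₁.comp (contMDiff_snd.comp Ψ.symm.contMDiff)).prodMk
      (contMDiff_fst.comp Ψ.symm.contMDiff)
  · let π : U × N → (U ⧸ K.comap ιU) × N := fun x => (x.1, x.2)
    have hπ : ContMDiff (𝓘(ℝ, EU).prod 𝓘(ℝ, EN)) (𝓘(ℝ, F₁).prod 𝓘(ℝ, EN)) ∞ π :=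
      (s₁.comp contMDiff_fst).prodMk contMDiff_snd
    refine contMDiff_of_comp_submersion (π := π) hπ (fun x => ?_) ?_ ?_
    · have h1 := ((s₁ x.1).mdifferentiableAt (by simp)).hasCoordDerivAt
      have h2 := (h1.comp x (hasCoordDerivAt_fst (I' := 𝓘(ℝ, EN)) x) rfl).prodMk
        (hasCoordDerivAt_snd x)
      have h3 : Function.Surjective
          (coordDeriv (𝓘(ℝ, EU).prod 𝓘(ℝ, EN)) (𝓘(ℝ, F₁).prod 𝓘(ℝ, EN)) π x) := by
        rw [h2.coordDeriv_eq]
        rintro ⟨v, w⟩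
        obtain ⟨v', hv'⟩ := d₁ x.1 v
        exact ⟨(v', w), Prod.ext hv' rfl⟩
      exact h3
    · rintro ⟨q, n⟩
      obtain ⟨u, rfl⟩ := QuotientGroup.mk_surjective q
      exact ⟨(u, n), rfl⟩
    · have h1 : ContMDiff (𝓘(ℝ, EU).prod 𝓘(ℝ, EN)) 𝓘(ℝ, E) ∞ (fun x : U × N => Ψ (x.2, x.1)) :=
        Ψ.contMDiff.comp (contMDiff_snd.prodMk contMDiff_fst)
      refine (s₀.comp h1).congr fun x => ?_
      change ((ιN x.2 * ιU x.1 : G) : G ⧸ K) = ((Ψ (x.2, x.1) : G) : G ⧸ K)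
      rw [hΨ]

end SemidirectCosets

/-! ### Lie subgroups and their Lie algebras -/

section Subgroups

variable {E : Type*} [NormedAddCommGroup E] [NormedSpace ℝ E]
  {G : Type*} [TopologicalSpace G] [ChartedSpace E G] [Group G]
  {EL : Type*} [NormedAddCommGroup EL] [NormedSpace ℝ EL]
  {L : Type*} [TopologicalSpace L] [ChartedSpace EL L] [Group L]

/-- The derivative at `1` of the inclusion of a Lie subgroup, as a map of model spaces. -/
theorem IsLieSubgroup.exists_hasCoordDerivAt {ι : L →* G}
    {V : Type*} [AddCommGroup V] [Module ℝ V] {𝔰 : Submodule ℝ V}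
    {e : V →ₗ[ℝ] GroupLieAlgebra 𝓘(ℝ, E) G}
    (h : IsLieSubgroup (EL := EL) ι (𝔰.map e)) :
    ∃ ι' : EL →L[ℝ] E, HasCoordDerivAt 𝓘(ℝ, EL) 𝓘(ℝ, E) ι 1 ι' ∧ Function.Injective ι' ∧
      (∀ v, ∃ X ∈ 𝔰, (e X : E) = ι' v) ∧ ∀ X ∈ 𝔰, ∃ v, ι' v = e X := by
  refine ⟨_, (h.contMDiff.mdifferentiable (by simp) 1).hasCoordDerivAt, h.immersion 1,
    fun v => ?_, fun X hX => ?_⟩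
  · exact (h.range_mfderiv _).2 ⟨v, rfl⟩
  · exact (h.range_mfderiv _).1 ⟨X, hX, rfl⟩

theorem finrank_eq_of_range_eq_map {V : Type*} [AddCommGroup V] [Module ℝ V] {𝔰 : Submodule ℝ V}
    {e : V →ₗ[ℝ] E} (he : Function.Injective e) {ι' : EL →L[ℝ] E} (hι : Function.Injective ι')
    (h1 : ∀ v, ∃ X ∈ 𝔰, e X = ι' v) (h2 : ∀ X ∈ 𝔰, ∃ v, ι' v = e X) :
    Module.finrank ℝ EL = Module.finrank ℝ 𝔰 := by
  have h3 : (ι' : EL →ₗ[ℝ] E).range = 𝔰.map e := by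
    ext y
    constructor
    · rintro ⟨v, rfl⟩; exact h1 v
    · rintro ⟨X, hX, rfl⟩; exact h2 X hX
  rw [← LinearMap.finrank_range_of_inj (f := (ι' : EL →ₗ[ℝ] E)) hι, h3]
  exact (Submodule.equivMapOfInjective e he 𝔰).finrank_eq.symm

end Subgroups

/-! ### The Lie group of the construction -/

theorem proposition5p2
    {𝔲 𝔫 : Type*} [LieRing 𝔲] [LieAlgebra ℝ 𝔲] [FiniteDimensional ℝ 𝔲]
    [LieRing 𝔫] [LieAlgebra ℝ 𝔫] [FiniteDimensional ℝ 𝔫]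
    (S : SolitonData 𝔲 𝔫)
    -- the simply connected Lie group `G`, with Lie algebra `𝔤 = 𝔲 ⋉ 𝔫`
    {E : Type*} [NormedAddCommGroup E] [NormedSpace ℝ E] [FiniteDimensional ℝ E]
    {G : Type*} [TopologicalSpace G] [T2Space G] [ChartedSpace E G] [Group G]
    [LieGroup 𝓘(ℝ, E) ∞ G] [SimplyConnectedSpace G]
    (e : S.total ≃ₗ⁅ℝ⁆ GroupLieAlgebra 𝓘(ℝ, E) G)
    -- the closed connected Lie subgroup `K`, with Lie algebra `𝔨`
    {EK : Type*} [NormedAddCommGroup EK] [NormedSpace ℝ EK] [FiniteDimensional ℝ EK]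
    (K : Subgroup G) [ChartedSpace EK K] [LieGroup 𝓘(ℝ, EK) ∞ K] [ConnectedSpace K]
    (hK_closed : IsClosed (K : Set G))
    (hK : IsLieSubgroup (EL := EK) K.subtype
      (S.totalDec.k.toSubmodule.map (e : S.total →ₗ[ℝ] GroupLieAlgebra 𝓘(ℝ, E) G)))
    -- the connected Lie subgroup `U`, with Lie algebra `𝔲`
    {EU : Type*} [NormedAddCommGroup EU] [NormedSpace ℝ EU] [FiniteDimensional ℝ EU]
    {U : Type*} [TopologicalSpace U] [ChartedSpace EU U] [Group U]
    [LieGroup 𝓘(ℝ, EU) ∞ U] [ConnectedSpace U] (ιU : U →* G)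
    (hU : IsLieSubgroup (EL := EU) ιU (S.uSub.map (e : S.total →ₗ[ℝ] GroupLieAlgebra 𝓘(ℝ, E) G)))
    -- the connected Lie subgroup `N`, with Lie algebra `𝔫`
    {EN : Type*} [NormedAddCommGroup EN] [NormedSpace ℝ EN] [FiniteDimensional ℝ EN]
    {N : Type*} [TopologicalSpace N] [ChartedSpace EN N] [Group N]
    [LieGroup 𝓘(ℝ, EN) ∞ N] [ConnectedSpace N] (ιN : N →* G)
    (hN : IsLieSubgroup (EL := EN) ιN (S.nSub.map (e : S.total →ₗ[ℝ] GroupLieAlgebra 𝓘(ℝ, E) G))) :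
    IsLieSemidirectProduct (E := E) (EU := EU) (EN := EN) ιU ιN ∧
    SimplyConnectedSpace U ∧ SimplyConnectedSpace N ∧
    K ≤ ιU.range ∧
    (∃ cG : ChartedSpace (EuclideanSpace ℝ (Fin (Module.finrank ℝ S.totalDec.p))) (G ⧸ K),
      IsHomogeneousManifold (E := E) K cG) ∧
    (∃ cU : ChartedSpace (EuclideanSpace ℝ (Fin (Module.finrank ℝ S.decU.p)))
        (U ⧸ K.comap ιU),
      IsHomogeneousManifold (E := EU) (K.comap ιU) cU) ∧
    ∀ (cG : ChartedSpace (EuclideanSpace ℝ (Fin (Module.finrank ℝ S.totalDec.p))) (G ⧸ K))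
      (cU : ChartedSpace (EuclideanSpace ℝ (Fin (Module.finrank ℝ S.decU.p)))
        (U ⧸ K.comap ιU)),
      IsHomogeneousManifold (E := E) K cG →
      IsHomogeneousManifold (E := EU) (K.comap ιU) cU →
      DiffeomorphicToProd (F₂ := EN) (N₂ := N) cG cU := by
  have : IsTopologicalGroup G := topologicalGroup_of_lieGroup 𝓘(ℝ, E) ∞
  have : IsTopologicalGroup U := topologicalGroup_of_lieGroup 𝓘(ℝ, EU) ∞
  have : FiniteDimensional ℝ S.total :=
    (LieAlgebra.SemiDirectSum.toProdl S.θ).symm.finiteDimensional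
  obtain ⟨K', hK1, hK2, hK3, hK4⟩ := hK.exists_hasCoordDerivAt
  obtain ⟨U', hU1, hU2, hU3, hU4⟩ := hU.exists_hasCoordDerivAt
  obtain ⟨N', hN1, hN2, hN3, hN4⟩ := hN.exists_hasCoordDerivAt
  let ε : S.total ≃ₗ[ℝ] E := e.toLinearEquiv
  have hε (X Y : S.total) : modelBracket E G (ε X) (ε Y) = ε ⁅X, Y⁆ :=
    (modelBracket_apply (E := E) (G := G) (e X) (e Y)).trans (LieEquiv.map_lie e X Y).symm
  -- `N'` and `U'` identify the model spaces of `N` and `U` with `𝔫` and `𝔲`.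
  have hN5 (X : 𝔫) : ∃ v, N' v = ε ⟨X, 0⟩ := hN4 _ ⟨X, rfl⟩
  have hN6 (v : EN) : ∃ X : 𝔫, ε ⟨X, 0⟩ = N' v := by
    obtain ⟨_, ⟨X, rfl⟩, hX⟩ := hN3 v
    exact ⟨X, hX⟩
  have hU5 (Y : 𝔲) : ∃ v, U' v = ε ⟨0, Y⟩ := hU4 _ ⟨Y, rfl⟩
  have hU6 (v : EU) : ∃ Y : 𝔲, ε ⟨0, Y⟩ = U' v := by
    obtain ⟨_, ⟨Y, rfl⟩, hY⟩ := hU3 v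
    exact ⟨Y, hY⟩
  have hK6 (v : EK) : ∃ Z ∈ S.decU.k, ε ⟨0, Z⟩ = K' v := by
    obtain ⟨_, ⟨Z, hZ, rfl⟩, h⟩ := hK3 v
    exact ⟨Z, hZ, h⟩
  -- `𝔫` is an ideal.
  have hI (X : E) (v : EN) : ∃ w, modelBracket E G X (N' v) = N' w := by
    obtain ⟨x, rfl⟩ := ε.surjective X
    obtain ⟨n, hn⟩ := hN6 v
    obtain ⟨w, hw⟩ := hN5 (⁅x.left, n⁆ + S.θ x.right n)
    refine ⟨w, ?_⟩
    rw [← hn, hε, hw]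
    simp
  have hI' (X : E) (v : EN) : ∃ w, modelBracket E G (N' v) X = N' w := by
    obtain ⟨x, rfl⟩ := ε.surjective X
    obtain ⟨n, hn⟩ := hN6 v
    obtain ⟨w, hw⟩ := hN5 (⁅n, x.left⁆ - S.θ x.right n)
    refine ⟨w, ?_⟩
    rw [← hn, hε, hw]
    simp
  have hV : ∀ X, ∀ Y ∈ (N' : EN →ₗ[ℝ] E).range, modelBracket E G X Y ∈ (N' : EN →ₗ[ℝ] E).range := by
    rintro X _ ⟨v, rfl⟩
    obtain ⟨w, hw⟩ := hI X v
    exact ⟨w, hw.symm⟩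
  have hV' : ∀ X ∈ (N' : EN →ₗ[ℝ] E).range, ∀ Y,
      modelBracket E G X Y ∈ (N' : EN →ₗ[ℝ] E).range := by
    rintro _ ⟨v, rfl⟩ X
    obtain ⟨w, hw⟩ := hI' X v
    exact ⟨w, hw.symm⟩
  have hbij : Function.Bijective (N'.coprod U') := by
    constructor
    · rw [injective_iff_map_eq_zero]
      rintro ⟨v, w⟩ h
      obtain ⟨X, hX⟩ := hN6 v
      obtain ⟨Y, hY⟩ := hU6 w
      have h1 : ε (⟨X, 0⟩ + ⟨0, Y⟩) = 0 := by rw [map_add, hX, hY]; exact h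
      rw [map_eq_zero_iff _ ε.injective] at h1
      simp only [LieAlgebra.SemiDirectSum.add_eq_mk, add_zero, zero_add,
        LieAlgebra.SemiDirectSum.zero_eq_mk, LieAlgebra.SemiDirectSum.mk.injEq] at h1
      obtain ⟨rfl, rfl⟩ := h1
      have h0 : ε ⟨0, 0⟩ = 0 := map_zero ε
      rw [h0] at hX hY
      exact Prod.ext (hN2 (hX.symm.trans (map_zero N').symm))
        (hU2 (hY.symm.trans (map_zero U').symm))
    · intro y
      obtain ⟨x, rfl⟩ := ε.surjective y
      obtain ⟨v, hv⟩ := hN5 x.left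
      obtain ⟨w, hw⟩ := hU5 x.right
      refine ⟨(v, w), ?_⟩
      change N' v + U' w = ε x
      rw [hv, hw, ← map_add]
      simp
  have hT : IsTransversalPair ιN ιU N' U' :=
    { contMDiff_left := hN.contMDiff
      contMDiff_right := hU.contMDiff
      hasCoordDerivAt_left := hN1
      hasCoordDerivAt_right := hU1
      bijective := hbij
      adjointRep_mem := fun g v => by
        obtain ⟨w, hw⟩ := adjointRep_mem_of_ideal hV g ⟨v, rfl⟩
        exact ⟨w, hw.symm⟩ }
  have hAd (n : N) (Y : E) : ∃ w, adjointRep (ιN n) Y - Y = N' w := by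
    obtain ⟨w, hw⟩ := adjointRep_sub_mem_of_ideal hV hV' hN1 (fun v => ⟨v, rfl⟩) n Y
    exact ⟨w, hw.symm⟩
  have hprod := hT.isLieSemidirectProduct hN.injective hAd
  refine ⟨hprod, ?_⟩
  obtain ⟨φ, -, -, Φ, Ψ, hΦ, hΨΦ⟩ := hprod
  have hΨ (n : N) (u : U) : Ψ (n, u) = ιN n * ιU u := (hΨΦ ⟨n, u⟩).trans (hΦ _)
  have hΨ' (n : N) (u : U) : Ψ.symm (ιN n * ιU u) = (n, u) := by
    rw [← hΨ]; exact Ψ.symm_apply_apply _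
  -- The inclusion of `K` is tangent to `U`.
  obtain ⟨j, hj, hjι⟩ : ∃ j : K → U, ContMDiff 𝓘(ℝ, EK) 𝓘(ℝ, EU) ∞ j ∧
      ∀ k, ιU (j k) = K.subtype k := by
    refine exists_contMDiff_lift (x₁ := 1) hU.injective
      (hT.exists_local_lift_right hK.contMDiff ?_) (by simp)
    intro x A hA v
    obtain ⟨B, hB⟩ := exists_hasLogDerivAt (IM := 𝓘(ℝ, EK)) (f := fun k : K => k) (x := x)
      mdifferentiableAt_id
    obtain ⟨Z, -, hZ⟩ := hK6 (B v)
    obtain ⟨w, hw⟩ := hU5 Z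
    refine ⟨w, ?_⟩
    rw [hA.unique (hB.monoidHom_comp hK1), hw, hZ]
    rfl
  let J : K →* U :=
    { toFun := j
      map_one' := hU.injective (by simp [hjι])
      map_mul' := fun a b => hU.injective (by simp [hjι]) }
  have hJι (k : K) : ιU (J k) = k := hjι k
  have hJr : J.range = K.comap ιU := by
    ext u
    constructor
    · rintro ⟨k, rfl⟩
      rw [Subgroup.mem_comap, hJι]; exact k.2
    · intro hu
      exact ⟨⟨ιU u, hu⟩, hU.injective (hJι _)⟩
  have hJi : IsInducing J := by
    refine IsInducing.of_comp hj.continuous hU.contMDiff.continuous ?_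
    have : ιU ∘ J = ((↑) : K → G) := funext hJι
    rw [this]
    exact IsInducing.subtypeVal
  have hJd := (hj.mdifferentiable (by simp) 1).hasCoordDerivAt
  have hJd' : Function.Injective (coordDeriv 𝓘(ℝ, EK) 𝓘(ℝ, EU) j 1) := by
    have h1 := hU1.comp 1 hJd (map_one J)
    have h2 := hK1.unique (h1.congr (Eventually.of_forall fun k => (hjι k).symm))
    rw [h2] at hK2
    exact Function.Injective.of_comp hK2
  have hKr : K ≤ ιU.range := fun k hk => ⟨j ⟨k, hk⟩, hjι _⟩
  have hdK : Module.finrank ℝ EK = Module.finrank ℝ S.totalDec.k.toSubmodule :=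
    finrank_eq_of_range_eq_map (e := (ε : S.total →ₗ[ℝ] E)) ε.injective hK2 hK3 hK4
  have hdK' : Module.finrank ℝ S.totalDec.k.toSubmodule
      = Module.finrank ℝ S.decU.k.toSubmodule :=
    (Submodule.equivMapOfInjective
      (LieAlgebra.SemiDirectSum.inr S.θ : 𝔲 →ₗ[ℝ] S.total)
      (fun x y h => congrArg LieAlgebra.SemiDirectSum.right h) S.decU.k.toSubmodule).finrank_eq.symm
  have hdU : Module.finrank ℝ EU = Module.finrank ℝ 𝔲 := by
    rw [finrank_eq_of_range_eq_map (e := (ε : S.total →ₗ[ℝ] E)) ε.injective hU2 hU3 hU4]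
    exact LinearMap.finrank_range_of_inj
      (fun x y h => congrArg LieAlgebra.SemiDirectSum.right h)
  have hdG := Submodule.finrank_add_eq_of_isCompl S.totalDec.isCompl
  have hdG' := Submodule.finrank_add_eq_of_isCompl S.decU.isCompl
  have hdE : Module.finrank ℝ S.total = Module.finrank ℝ E := ε.finrank_eq
  refine ⟨?_, ?_, hKr, ?_, ?_, ?_⟩
  · refine SimplyConnectedSpace.of_retract (i := ιU) (r := fun g => (Ψ.symm g).2)
      hU.contMDiff.continuous (continuous_snd.comp Ψ.symm.continuous) fun u => ?_
    simpa using congrArg Prod.snd (hΨ' 1 u)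
  · refine SimplyConnectedSpace.of_retract (i := ιN) (r := fun g => (Ψ.symm g).1)
      hN.contMDiff.continuous (continuous_fst.comp Ψ.symm.continuous) fun n => ?_
    simpa using congrArg Prod.fst (hΨ' n 1)
  · obtain ⟨C⟩ := exists_cosetSlice
      (W := EuclideanSpace ℝ (Fin (Module.finrank ℝ S.totalDec.p))) hK.contMDiff
      IsInducing.subtypeVal hK1 hK2 (by rw [finrank_euclideanSpace_fin]; omega)
    rw [K.range_subtype] at C
    exact ⟨_, C.isHomogeneousManifold⟩
  · obtain ⟨C⟩ := exists_cosetSlice (j := J)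
      (W := EuclideanSpace ℝ (Fin (Module.finrank ℝ S.decU.p))) hj
      hJi hJd hJd' (by rw [finrank_euclideanSpace_fin]; omega)
    rw [hJr] at C
    exact ⟨_, C.isHomogeneousManifold⟩
  · intro cG cU h₀ h₁
    exact nonempty_diffeomorph_coset_prod h₀ h₁ Ψ hΨ hKr
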